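/- All Hilbert spaces are finite-dimensional, and entropic quantities take values in $[-\infty,+\infty]$ (with $\log 0=-\infty$; $\log$ is the natural logarithm, and maxima and minima are understood as suprema and infima). Let $\mathsf S_=(\mathcal H)$ and $\mathsf S_\le(\mathcal H)$ be the sets of positive semidefinite operators on $\mathcal H$ of trace $=1$ and $\le 1$, respectively. **Relative entropies and conditional entropies.** For positive semidefinite $P,Q$ put $$D_{\max}(P\|Q)=\log\min\{\lambda\ge 0: P\le\lambda Q\},\qquad D_{\mathrm{fid}}(P\|Q)=-2\log \mathrm{Tr}\big[(\sqrt P\,Q\sqrt P)^{1/2}\big],$$ where $D_{\max}(P\|Q)=+\infty$ if there is no such $\lambda$. For $\rho_{AB}\in\mathsf S_\le(\mathcal H_{AB})$ put $$H_{\min}(A|B)_\rho=\max_{\tau\in \mathsf S_=(\mathcal H_B)}\big[-D_{\max}(\rho_{AB}\|\mathbb 1\otimes\tau)\big],\qquad H_{\max}(A|B)_\rho=\max_{\tau\in \mathsf S_=(\mathcal H_B)}\big[-D_{\mathrm{fid}}(\rho_{AB}\|\mathbb 1\otimes\tau)\big].$$ **Correlation measures.** Let $\mathsf{Sep}$ be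 the set of states $\sum_j p_j\,\rho_{A,j}\otimes\rho_{B,j}$, $\mathsf{CQ}$ the set of states $\sum_j p_j\,|j\rangle\langle j|\otimes\rho_{B,j}$, $\mathsf{QC}$ the set of states $\sum_k p_k\,\rho_{A,k}\otimes|k\rangle\langle k|$, and $\mathsf{CC}$ the set of states $\sum_{j,k}p_{j,k}\,|j\rangle\langle j|\otimes|k\rangle\langle k|$, where $p$ is a finite probability distribution, $\rho_{A,j},\rho_{B,j}$ are density operators, and $\{|j\rangle\}$, $\{|k\rangle\}$ are arbitrary orthonormal bases of $\mathcal H_A$, $\mathcal H_B$. For $K\in\{\max,\mathrm{fid}\}$ let $\mathbb E_K^{A|B}(\rho)$, $\Delta_K^{\overrightarrow{A|B}}(\rho)$, $\Delta_K^{\overrightarrow{B|A}}(\rho)$, $\Delta_K^{\overleftrightarrow{A|B}}(\rho)$ be the minimum of $D_K(\rho\|\sigma)$ over $\sigma$ in $\mathsf{Sep}$, $\mathsf{CQ}$, $\mathsf{QC}$, $\mathsf{CC}$, respectively. **Smoothing.** For $\rho,\sigma\in\mathsf S_\le$ let $\overline F(\rho,\sigma)=\mathrm{Tr}[(\sqrt\sigma\rho\sqrt\sigma)^{1/2}]+\sqrt{(1-\mathrm{Tr}\rho)(1-\mathrm{Tr}\sigma)}$,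 let $P(\rho,\sigma)=\sqrt{1-\overline F(\rho,\sigma)^2}$ be the purified distance, and let $\mathcal B^\epsilon(\rho)=\{\sigma\in\mathsf S_\le: P(\rho,\sigma)\le\epsilon\}$. For $\sigma$ ranging over $\mathcal B^\epsilon(\rho)$ define $$H^\epsilon_{\min}(A|B)_\rho=\max_{\sigma}H_{\min}(A|B)_\sigma,\qquad H^\epsilon_{\max}(A|B)_\rho=\min_{\sigma}H_{\max}(A|B)_\sigma,$$ $${}_\epsilon M_{\max}(\rho)=\min_{\sigma} M_{\max}(\sigma),\qquad {}_\epsilon M_{\mathrm{fid}}(\rho)=\max_{\sigma}M_{\mathrm{fid}}(\sigma)$$ for each $M\in\{\mathbb E^{A|B},\Delta^{\overrightarrow{A|B}},\Delta^{\overrightarrow{B|A}},\Delta^{\overleftrightarrow{A|B}}\}$. **Premeasurement.** Let $X=\{X_j\}$ be a finite family of mutually orthogonal projectors on $\mathcal H_S$ (not necessarily of rank one) summing to the identity, let $\{|j\rangle\}$ be an orthonormal family in $\mathcal H_{M_X}$, and let $V_X=\sum_j|j\rangle\otimes X_j:\mathcal H_S\to\mathcal H_{M_X}\otimes\mathcal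 H_S$. Let $\rho_S$ be a density operator and $|\psi\rangle\in\mathcal H_S\otimes\mathcal H_E$ any purification of it. Put $\tilde\rho_{M_XS}=V_X\rho_SV_X^\dagger$, let $\tilde\rho_{M_XE}$ be the marginal on $M_XE$ of the pure state $(V_X\otimes\mathbb 1_E)|\psi\rangle$, and set $H^\epsilon_{\min}(X|E)=H^\epsilon_{\min}(M_X|E)_{\tilde\rho}$ and $H^\epsilon_{\max}(X|E)=H^\epsilon_{\max}(M_X|E)_{\tilde\rho}$. **Claim.** For every $\epsilon\ge0$, with all measures on the right evaluated on $\tilde\rho_{M_XS}$, $$H^\epsilon_{\min}(X|E)={}_\epsilon\mathbb E^{M_X|S}_{\mathrm{fid}}={}_\epsilon\Delta^{\overrightarrow{M_X|S}}_{\mathrm{fid}}={}_\epsilon\Delta^{\overrightarrow{S|M_X}}_{\mathrm{fid}}={}_\epsilon\Delta^{\overleftrightarrow{M_X|S}}_{\mathrm{fid}},$$ $$H^\epsilon_{\max}(X|E)={}_\epsilon\mathbb E^{M_X|S}_{\max}={}_\epsilon\Delta^{\overrightarrow{M_X|S}}_{\max}={}_\epsilon\Delta^{\overrightarrow{S|M_X}}_{\max}={}_\epsilon\Delta^{\overleftrightarrow{M_X|S}}_{\max}.$$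 -/

import Mathlib

open scoped Kronecker ComplexOrder MatrixOrder ENNReal NNReal

noncomputable section

namespace QCorr

/-! Operators on a finite-dimensional Hilbert space are complex matrices; the composite of the
systems with index types `a` and `b` has index type `a × b`. -/

variable {a b c n J : Type*} [Fintype a] [DecidableEq a] [Fintype b] [DecidableEq b]
  [Fintype c] [Fintype n] [DecidableEq n] [Fintype J]

/-- Normalized density operators. -/
def IsDensity (ρ : Matrix n n ℂ) : Prop :=
  ρ.PosSemidef ∧ ρ.trace = 1

/-- Subnormalized positive operators. -/
def IsSubDensity (ρ : Matrix n n ℂ) : Prop :=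
  ρ.PosSemidef ∧ ρ.trace.re ≤ 1

/-- The rank-one operator `|v⟩⟨v|`. -/
def ketbra (v : EuclideanSpace ℂ n) : Matrix n n ℂ :=
  Matrix.vecMulVec v.ofLp (star v.ofLp)

/-- Partial trace over the second system. -/
def traceRight (ρ : Matrix (a × b) (a × b) ℂ) : Matrix a a ℂ :=
  Matrix.of fun i i' => ∑ k, ρ (i, k) (i', k)

/-- Partial trace over the middle one of three systems. -/
def traceMid (ρ : Matrix ((a × b) × c) ((a × b) × c) ℂ) : Matrix (a × c) (a × c) ℂ :=
  Matrix.of fun p q => ∑ k, ρ ((p.1, k), p.2) ((q.1, k), q.2)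

/-! ### Classes of bipartite states -/

/-- Separable states `∑ j, p j • (A j ⊗ B j)`. -/
def Sep : Set (Matrix (a × b) (a × b) ℂ) :=
  {ρ | ∃ (N : ℕ) (p : Fin N → ℝ) (A : Fin N → Matrix a a ℂ) (B : Fin N → Matrix b b ℂ),
    (∀ j, 0 ≤ p j) ∧ ∑ j, p j = 1 ∧ (∀ j, IsDensity (A j)) ∧ (∀ j, IsDensity (B j)) ∧
    ρ = ∑ j, (p j : ℂ) • (A j ⊗ₖ B j)}

/-- Classical-quantum states `∑ j, p j • (|u j⟩⟨u j| ⊗ B j)`, with `u` an orthonormal basis of the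
first system. -/
def CQ : Set (Matrix (a × b) (a × b) ℂ) :=
  {ρ | ∃ (u : OrthonormalBasis a ℂ (EuclideanSpace ℂ a)) (p : a → ℝ) (B : a → Matrix b b ℂ),
    (∀ j, 0 ≤ p j) ∧ ∑ j, p j = 1 ∧ (∀ j, IsDensity (B j)) ∧
    ρ = ∑ j, (p j : ℂ) • (ketbra (u j) ⊗ₖ B j)}

/-- Quantum-classical states `∑ k, p k • (A k ⊗ |v k⟩⟨v k|)`, with `v` an orthonormal basis of the
second system. -/
def QC : Set (Matrix (a × b) (a × b) ℂ) :=
  {ρ | ∃ (v : OrthonormalBasis b ℂ (EuclideanSpace ℂ b)) (p : b → ℝ) (A : b → Matrix a a ℂ),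
    (∀ k, 0 ≤ p k) ∧ ∑ k, p k = 1 ∧ (∀ k, IsDensity (A k)) ∧
    ρ = ∑ k, (p k : ℂ) • (A k ⊗ₖ ketbra (v k))}

/-- Classical-classical states `∑ j k, p j k • (|u j⟩⟨u j| ⊗ |v k⟩⟨v k|)`. -/
def CC : Set (Matrix (a × b) (a × b) ℂ) :=
  {ρ | ∃ (u : OrthonormalBasis a ℂ (EuclideanSpace ℂ a))
      (v : OrthonormalBasis b ℂ (EuclideanSpace ℂ b)) (p : a → b → ℝ),
    (∀ j k, 0 ≤ p j k) ∧ ∑ j, ∑ k, p j k = 1 ∧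
    ρ = ∑ j, ∑ k, (p j k : ℂ) • (ketbra (u j) ⊗ₖ ketbra (v k))}

/-! ### Fidelity, purified distance, and the two relative entropies -/

/-- Fidelity `F(ρ, σ) = Tr (√σ ρ √σ)^{1/2}`. -/
def fid (ρ σ : Matrix n n ℂ) : ℝ :=
  (CFC.sqrt (CFC.sqrt σ * ρ * CFC.sqrt σ)).trace.re

/-- Generalized fidelity of subnormalized operators. -/
def genFid (ρ σ : Matrix n n ℂ) : ℝ :=
  fid ρ σ + √((1 - ρ.trace.re) * (1 - σ.trace.re))

/-- Purified distance. -/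
def purifiedDist (ρ σ : Matrix n n ℂ) : ℝ :=
  √(1 - genFid ρ σ ^ 2)

/-- The `ε`-ball of subnormalized operators around `ρ`. -/
def epsBall (ε : ℝ) (ρ : Matrix n n ℂ) : Set (Matrix n n ℂ) :=
  {σ | IsSubDensity σ ∧ purifiedDist ρ σ ≤ ε}

/-- `D_max(P‖Q) = log min {lam : P ≤ lam Q}`, in the extended reals: `log 0 = -∞`, and the value is
`+∞` when no such `lam` exists. -/
def dMax (P Q : Matrix n n ℂ) : EReal :=
  ⨅ (lam : ℝ≥0) (_ : P ≤ (lam : ℂ) • Q), ENNReal.log (lam : ℝ≥0∞)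

/-- `D_fid(P‖Q) = -2 log Tr (√P Q √P)^{1/2}`, equal to `+∞` when the trace vanishes. -/
def dFid (P Q : Matrix n n ℂ) : EReal :=
  -(2 * ENNReal.log (ENNReal.ofReal (fid Q P)))

/-! ### Conditional entropies and correlation measures -/

/-- `H(A|B) = max_τ [-D(ρ ‖ 1 ⊗ τ)]` over normalized density operators `τ` on the second system. -/
def condEntropy
    (D : Matrix (a × b) (a × b) ℂ → Matrix (a × b) (a × b) ℂ → EReal)
    (ρ : Matrix (a × b) (a × b) ℂ) : EReal :=
  ⨆ (τ : Matrix b b ℂ) (_ : IsDensity τ), -D ρ ((1 : Matrix a a ℂ) ⊗ₖ τ)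

/-- The distance, measured by `D`, from `ρ` to the set `K` of states. -/
def distTo (D : Matrix n n ℂ → Matrix n n ℂ → EReal) (K : Set (Matrix n n ℂ))
    (ρ : Matrix n n ℂ) : EReal :=
  ⨅ σ ∈ K, D ρ σ

/-- Smoothing of `f` by minimization over the `ε`-ball. -/
def smoothInf (ε : ℝ) (f : Matrix n n ℂ → EReal) (ρ : Matrix n n ℂ) : EReal :=
  ⨅ σ ∈ epsBall ε ρ, f σ

/-- Smoothing of `f` by maximization over the `ε`-ball. -/
def smoothSup (ε : ℝ) (f : Matrix n n ℂ → EReal) (ρ : Matrix n n ℂ) : EReal :=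
  ⨆ σ ∈ epsBall ε ρ, f σ

/-- Smooth min-entropy of the first system given the second. -/
def smoothHMin (ε : ℝ) (ρ : Matrix (a × b) (a × b) ℂ) : EReal :=
  smoothSup ε (condEntropy dMax) ρ

/-- Smooth max-entropy of the first system given the second. -/
def smoothHMax (ε : ℝ) (ρ : Matrix (a × b) (a × b) ℂ) : EReal :=
  smoothInf ε (condEntropy dFid) ρ

/-! Smooth entanglement, the one-way discords with the first, respectively the second, system
classical, and the two-way discord. -/

def smoothEntMax (ε : ℝ) (ρ : Matrix (a × b) (a × b) ℂ) : EReal :=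
  smoothInf ε (distTo dMax Sep) ρ

def smoothDiscordFstMax (ε : ℝ) (ρ : Matrix (a × b) (a × b) ℂ) : EReal :=
  smoothInf ε (distTo dMax CQ) ρ

def smoothDiscordSndMax (ε : ℝ) (ρ : Matrix (a × b) (a × b) ℂ) : EReal :=
  smoothInf ε (distTo dMax QC) ρ

def smoothDiscordTwoMax (ε : ℝ) (ρ : Matrix (a × b) (a × b) ℂ) : EReal :=
  smoothInf ε (distTo dMax CC) ρ

def smoothEntFid (ε : ℝ) (ρ : Matrix (a × b) (a × b) ℂ) : EReal :=
  smoothSup ε (distTo dFid Sep) ρ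

def smoothDiscordFstFid (ε : ℝ) (ρ : Matrix (a × b) (a × b) ℂ) : EReal :=
  smoothSup ε (distTo dFid CQ) ρ

def smoothDiscordSndFid (ε : ℝ) (ρ : Matrix (a × b) (a × b) ℂ) : EReal :=
  smoothSup ε (distTo dFid QC) ρ

def smoothDiscordTwoFid (ε : ℝ) (ρ : Matrix (a × b) (a × b) ℂ) : EReal :=
  smoothSup ε (distTo dFid CC) ρ

/-! ### Premeasurement -/

/-- A projection valued measure: mutually orthogonal projectors summing to the identity. -/
structure IsPVM (X : J → Matrix n n ℂ) : Prop where
  isHermitian : ∀ j, (X j).IsHermitian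
  idem : ∀ j, X j * X j = X j
  orth : ∀ j k, j ≠ k → X j * X k = 0
  sum_eq_one : ∑ j, X j = 1

/-- The premeasurement isometry `V_X = ∑ j, |w j⟩ ⊗ X j` from the system (index `n`) to the device
and the system (index `a × n`). -/
def premeasIso (w : J → EuclideanSpace ℂ a) (X : J → Matrix n n ℂ) : Matrix (a × n) n ℂ :=
  Matrix.of fun p q => ∑ j, w j p.1 * X j p.2 q

/-- The premeasurement state `V_X ρ_S V_X†` of device and system. -/
def premeasState (w : J → EuclideanSpace ℂ a) (X : J → Matrix n n ℂ) (ρS : Matrix n n ℂ) :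
    Matrix (a × n) (a × n) ℂ :=
  premeasIso w X * ρS * (premeasIso w X).conjTranspose

/-- The state of device, system and environment after the premeasurement, starting from the pure
state `ψ` of system and environment. -/
def premeasGlobal [DecidableEq c] (w : J → EuclideanSpace ℂ a) (X : J → Matrix n n ℂ)
    (ψ : EuclideanSpace ℂ (n × c)) : Matrix ((a × n) × c) ((a × n) × c) ℂ :=
  (premeasIso w X ⊗ₖ (1 : Matrix c c ℂ)) * ketbra ψ *
    (premeasIso w X ⊗ₖ (1 : Matrix c c ℂ)).conjTranspose

/-- Smooth min-entropy `H^ε_min(X|E)` of the observable `X` given the environment, i.e. that of the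
device given the environment after the premeasurement. -/
def smoothHMinObs [DecidableEq c] (ε : ℝ) (w : J → EuclideanSpace ℂ a) (X : J → Matrix n n ℂ)
    (ψ : EuclideanSpace ℂ (n × c)) : EReal :=
  smoothHMin ε (traceMid (premeasGlobal w X ψ))

/-- Smooth max-entropy `H^ε_max(X|E)` of the observable `X` given the environment. -/
def smoothHMaxObs [DecidableEq c] (ε : ℝ) (w : J → EuclideanSpace ℂ a) (X : J → Matrix n n ℂ)
    (ψ : EuclideanSpace ℂ (n × c)) : EReal :=
  smoothHMax ε (traceMid (premeasGlobal w X ψ))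

end QCorr

end

/-! Two facts combine: duality of smooth min- and max-entropy, and the special support of the
premeasurement state.

Duality: read a pure tripartite vector as a matrix `K`, so that `K * Kᴴ` is one marginal and
`regroup K * (regroup K)ᴴ` the complementary one. For fixed operators, `-D_max` maximized over `1 ⊗
τ` on one marginal equals `D_fid` minimized over `1 ⊗ τ` on the other. One inequality is
Cauchy–Schwarz (`fid_sq_le_of_le`); the other separates a compact convex set from the positive cone
and turns the witness into an optimal `τ` (`exists_le_or_le_fid_sq`). An Uhlmann argument
(`exists_overlap_eq_fid`) carries a nearby operator across the bipartition, which gives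
`smoothHMin_eq` and `smoothHMax_eq`. Hence `H^ε(X|E)` is a smoothed distance from the state of
device and system to the operators `1 ⊗ τ`.

Support: a separable state lies below some `1 ⊗ τ`, so distances to `Sep`, `CQ`, `QC`, `CC` are at
least the distance to `1 ⊗ τ`. Conversely, the projection `P = ∑ j, |w j⟩⟨w j| ⊗ X j` fixes the
premeasurement state and sends `1 ⊗ τ` to `∑ j, |w j⟩⟨w j| ⊗ X j τ X j`. These blocks are mutually
orthogonal, hence jointly diagonalizable, so the image is in `CC`, the smallest class
(`premeasProj_conj_mem_CC`). Conjugation by `P` preserves the ball, so after smoothing all the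
distances coincide (`smoothInf_distTo_eq`). -/

noncomputable section

namespace QCorr

open Matrix

set_option linter.unusedSectionVars false

/-! ### Trace norm, polar decomposition and fidelity. -/

section TraceNorm

variable {n p q r : Type*} [Fintype n] [DecidableEq n] [Fintype p] [DecidableEq p]
  [Fintype q] [DecidableEq q] [Fintype r] [DecidableEq r]

/-- The trace norm `Tr (M† M)^{1/2}`. -/
def trNorm (M : Matrix p q ℂ) : ℝ :=
  (CFC.sqrt (Mᴴ * M)).trace.re

theorem posSemidef_sqrt (A : Matrix n n ℂ) : (CFC.sqrt A).PosSemidef :=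
  nonneg_iff_posSemidef.1 (CFC.sqrt_nonneg A)

theorem conjTranspose_sqrt (A : Matrix n n ℂ) : (CFC.sqrt A)ᴴ = CFC.sqrt A :=
  (posSemidef_sqrt A).isHermitian

theorem sqrt_mul_sqrt {A : Matrix n n ℂ} (hA : A.PosSemidef) : CFC.sqrt A * CFC.sqrt A = A :=
  CFC.sqrt_mul_sqrt_self A (nonneg_iff_posSemidef.2 hA)

theorem trace_re_nonneg {A : Matrix n n ℂ} (hA : A.PosSemidef) : 0 ≤ A.trace.re :=
  (Complex.le_def.1 hA.trace_nonneg).1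

theorem trace_re_mono {A B : Matrix n n ℂ} (h : A ≤ B) : A.trace.re ≤ B.trace.re := by
  have := trace_re_nonneg (le_iff.1 h)
  simpa [trace_sub] using this

theorem conj_mono {A B : Matrix n n ℂ} (h : A ≤ B) (C : Matrix p n ℂ) :
    C * A * Cᴴ ≤ C * B * Cᴴ := by
  have := (le_iff.1 h).mul_mul_conjTranspose_same C
  rw [le_iff]
  simpa [Matrix.mul_sub, Matrix.sub_mul] using this

theorem conj_mono' {A B : Matrix n n ℂ} (h : A ≤ B) (C : Matrix n p ℂ) :
    Cᴴ * A * C ≤ Cᴴ * B * C := by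
  simpa using conj_mono h Cᴴ

theorem trace_mul_re_mono {A B C : Matrix n n ℂ} (h : A ≤ B) (hC : C.PosSemidef) :
    (C * A).trace.re ≤ (C * B).trace.re := by
  have := trace_re_mono (conj_mono h (CFC.sqrt C))
  rw [conjTranspose_sqrt, Matrix.mul_assoc, Matrix.trace_mul_comm, Matrix.mul_assoc,
    sqrt_mul_sqrt hC, Matrix.mul_assoc, Matrix.trace_mul_comm (CFC.sqrt C), Matrix.mul_assoc,
    sqrt_mul_sqrt hC] at this
  rwa [Matrix.trace_mul_comm C, Matrix.trace_mul_comm C]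

/-- `1 - U Uᴴ` is the sum of the positive operators `U (1 - Uᴴ U) Uᴴ` and `(1 - U Uᴴ)²`. -/
theorem contraction_conjTranspose {U : Matrix p q ℂ} (hU : Uᴴ * U ≤ 1) : U * Uᴴ ≤ 1 := by
  have h1 := (le_iff.1 hU).mul_mul_conjTranspose_same U
  have h2 := posSemidef_conjTranspose_mul_self (1 - U * Uᴴ)
  rw [le_iff]
  convert h1.add h2 using 1
  simp only [conjTranspose_sub, conjTranspose_one, conjTranspose_mul, conjTranspose_conjTranspose]
  simp only [Matrix.mul_sub, Matrix.sub_mul, Matrix.mul_one, Matrix.one_mul, Matrix.mul_assoc]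
  abel

/-- Polar decomposition of a rectangular matrix. -/
theorem exists_polar (M : Matrix p q ℂ) : ∃ W : Matrix p q ℂ, Wᴴ * W ≤ 1 ∧
    Wᴴ * M = CFC.sqrt (Mᴴ * M) ∧ W * CFC.sqrt (Mᴴ * M) = M := by
  set N := Mᴴ * M with hN
  have hNp : N.PosSemidef := posSemidef_conjTranspose_mul_self M
  have hsa : IsSelfAdjoint N := hNp.isHermitian
  have hc : ∀ f : ℝ → ℝ, ContinuousOn f (spectrum ℝ N) := fun f =>
    (Matrix.finite_real_spectrum).continuousOn f
  -- Since `0⁻¹ = 0`, `f(N)` is the pseudo-inverse of `√N`, and `M f(N)` is the partial isometry of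
  -- the decomposition.
  set f : ℝ → ℝ := fun x => (√x)⁻¹
  have hS : CFC.sqrt N = cfc Real.sqrt N := by
    rw [CFC.sqrt_eq_real_sqrt N (nonneg_iff_posSemidef.2 hNp), cfcₙ_eq_cfc]
  have hNid : N = cfc (fun x : ℝ => x) N := (cfc_id' ℝ N).symm
  have hnn : ∀ x ∈ spectrum ℝ N, 0 ≤ x := fun x hx =>
    spectrum_nonneg_of_nonneg (nonneg_iff_posSemidef.2 hNp) hx
  have hfsa : (cfc f N)ᴴ = cfc f N := (cfc_predicate f N : IsSelfAdjoint _)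
  have hfN : cfc f N * N = CFC.sqrt N := by
    rw [hS]
    conv_lhs => rw [hNid, ← hNid]
    conv_lhs => enter [2]; rw [hNid]
    rw [← cfc_mul _ _ _ (hc _) (hc _)]
    refine cfc_congr fun x hx => ?_
    rcases (hnn x hx).eq_or_lt with h | h
    · simp [f, ← h]
    · have := Real.sqrt_pos.2 h
      simp only [f]
      field_simp
      rw [Real.sq_sqrt h.le]
  have hWM : (M * cfc f N)ᴴ * M = CFC.sqrt N := by
    rw [conjTranspose_mul, hfsa, Matrix.mul_assoc, ← hN, hfN]
  have hWW : (M * cfc f N)ᴴ * (M * cfc f N) = cfc (fun x => √x * f x) N := by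
    rw [← Matrix.mul_assoc, hWM, hS, ← cfc_mul _ _ _ (hc _) (hc _)]
  refine ⟨M * cfc f N, ?_, hWM, ?_⟩
  · rw [hWW]
    refine cfc_le_one _ _ fun x hx => ?_
    by_cases h : √x = 0
    · simp [h]
    · simp [f, h]
  · have hMW : Mᴴ * (M * cfc f N) = CFC.sqrt N := by
      have := congrArg conjTranspose hWM
      rwa [conjTranspose_mul, conjTranspose_conjTranspose, conjTranspose_sqrt] at this
    have hSWWS : CFC.sqrt N * ((M * cfc f N)ᴴ * (M * cfc f N)) * CFC.sqrt N = N := by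
      rw [hWW, hS, ← cfc_mul _ _ _ (hc _) (hc _), ← cfc_mul _ _ _ (hc _) (hc _)]
      conv_rhs => rw [hNid]
      refine cfc_congr fun x hx => ?_
      rcases (hnn x hx).eq_or_lt with h | h
      · simp [f, ← h]
      · have := Real.sqrt_pos.2 h
        simp only [f]
        field_simp
        rw [Real.sq_sqrt h.le]
    rw [← sub_eq_zero, ← conjTranspose_mul_self_eq_zero]
    set W := M * cfc f N
    have hSS := sqrt_mul_sqrt hNp
    have e : (W * CFC.sqrt N - M)ᴴ * (W * CFC.sqrt N - M)
        = CFC.sqrt N * (Wᴴ * W) * CFC.sqrt N - CFC.sqrt N * (Wᴴ * M)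
          - (Mᴴ * W) * CFC.sqrt N + Mᴴ * M := by
      rw [conjTranspose_sub, conjTranspose_mul, conjTranspose_sqrt]
      simp only [Matrix.mul_sub, Matrix.sub_mul, Matrix.mul_assoc]
      abel
    rw [e, hSWWS, hWM, hMW, hSS, ← hN]
    abel

theorem re_trace_conjTranspose_comm (A B : Matrix p q ℂ) :
    (Aᴴ * B).trace.re = (Bᴴ * A).trace.re := by
  have : (Aᴴ * B).trace = star (Bᴴ * A).trace := by
    rw [← trace_conjTranspose, conjTranspose_mul, conjTranspose_conjTranspose]
  rw [this]; simp

/-- The contraction bound for the trace norm. -/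
theorem re_trace_le_trNorm {U : Matrix p q ℂ} (hU : Uᴴ * U ≤ 1) (M : Matrix p q ℂ) :
    (Uᴴ * M).trace.re ≤ trNorm M := by
  obtain ⟨W, hW, -, hM⟩ := exists_polar M
  unfold trNorm
  set S := CFC.sqrt (Mᴴ * M)
  have hS : S.PosSemidef := posSemidef_sqrt _
  have hR : CFC.sqrt S * CFC.sqrt S = S := sqrt_mul_sqrt hS
  set R := CFC.sqrt S
  have hRh : Rᴴ = R := conjTranspose_sqrt _
  have key : ∀ V : Matrix p q ℂ, Vᴴ * V ≤ 1 → (R * (Vᴴ * V) * R).trace.re ≤ S.trace.re := by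
    intro V hV
    have := trace_re_mono (conj_mono hV R)
    rwa [hRh, Matrix.mul_one, hR] at this
  -- As `M = W R R`, expanding this square bounds twice the overlap of `U` with `M` by `Tr R WᴴW R +
  -- Tr R UᴴU R ≤ 2 Tr S`.
  have h0 := trace_re_nonneg (posSemidef_conjTranspose_mul_self (W * R - U * R))
  have e : (W * R - U * R)ᴴ * (W * R - U * R) = R * (Wᴴ * W) * R + R * (Uᴴ * U) * R
      - (W * R)ᴴ * (U * R) - (U * R)ᴴ * (W * R) := by
    simp only [conjTranspose_sub, conjTranspose_mul, hRh, Matrix.mul_sub, Matrix.sub_mul,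
      Matrix.mul_assoc]
    abel
  have h1 : ((U * R)ᴴ * (W * R)).trace = (Uᴴ * M).trace := by
    rw [conjTranspose_mul, hRh, Matrix.mul_assoc, Matrix.trace_mul_comm, Matrix.mul_assoc,
      Matrix.mul_assoc, hR, hM]
  rw [e, trace_sub, trace_sub, trace_add, Complex.sub_re, Complex.sub_re, Complex.add_re,
    re_trace_conjTranspose_comm (W * R), h1] at h0
  linarith [key W hW, key U hU]

theorem trNorm_le_conjTranspose (M : Matrix p q ℂ) : trNorm M ≤ trNorm Mᴴ := by
  obtain ⟨W, hW, hWM, -⟩ := exists_polar M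
  have h := re_trace_le_trNorm (U := Wᴴ) (by simpa using contraction_conjTranspose hW) Mᴴ
  rw [re_trace_conjTranspose_comm, conjTranspose_conjTranspose, Matrix.trace_mul_comm, hWM] at h
  exact h

theorem trNorm_conjTranspose (M : Matrix p q ℂ) : trNorm Mᴴ = trNorm M :=
  le_antisymm (by simpa using trNorm_le_conjTranspose Mᴴ) (trNorm_le_conjTranspose M)

theorem fid_nonneg (ρ σ : Matrix n n ℂ) : 0 ≤ fid ρ σ :=
  trace_re_nonneg (posSemidef_sqrt _)

/-- Frees the fidelity from square roots: any factorizations will do, because only the Gram matrix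
`Kᴴ L Lᴴ K` matters once the adjoint invariance of the trace norm is used. -/
theorem fid_mul_conjTranspose (K : Matrix n q ℂ) (L : Matrix n r ℂ) :
    fid (K * Kᴴ) (L * Lᴴ) = trNorm (Lᴴ * K) := by
  have h1 : fid (K * Kᴴ) (L * Lᴴ) = trNorm (CFC.sqrt (L * Lᴴ) * K)ᴴ := by
    unfold fid trNorm
    rw [conjTranspose_conjTranspose, conjTranspose_mul, conjTranspose_sqrt]
    simp only [Matrix.mul_assoc]
  rw [h1, trNorm_conjTranspose]
  unfold trNorm
  have h2 : (CFC.sqrt (L * Lᴴ) * K)ᴴ * (CFC.sqrt (L * Lᴴ) * K) = (Lᴴ * K)ᴴ * (Lᴴ * K) := by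
    rw [conjTranspose_mul, conjTranspose_sqrt, Matrix.mul_assoc, ← Matrix.mul_assoc (CFC.sqrt _),
      sqrt_mul_sqrt (posSemidef_self_mul_conjTranspose L), conjTranspose_mul,
      conjTranspose_conjTranspose]
    simp only [Matrix.mul_assoc]
  rw [h2]

theorem exists_eq_mul_conjTranspose {A : Matrix n n ℂ} (hA : A.PosSemidef) :
    ∃ K : Matrix n n ℂ, A = K * Kᴴ :=
  ⟨CFC.sqrt A, by rw [conjTranspose_sqrt, sqrt_mul_sqrt hA]⟩

theorem fid_comm {ρ σ : Matrix n n ℂ} (hρ : ρ.PosSemidef) (hσ : σ.PosSemidef) :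
    fid ρ σ = fid σ ρ := by
  obtain ⟨K, rfl⟩ := exists_eq_mul_conjTranspose hρ
  obtain ⟨L, rfl⟩ := exists_eq_mul_conjTranspose hσ
  rw [fid_mul_conjTranspose, fid_mul_conjTranspose, ← trNorm_conjTranspose, conjTranspose_mul,
    conjTranspose_conjTranspose]

/-- Moving an operator from one argument of the fidelity to the other. -/
theorem fid_conj {ρ σ : Matrix n n ℂ} (hρ : ρ.PosSemidef) (hσ : σ.PosSemidef)
    (P : Matrix n n ℂ) : fid (P * ρ * Pᴴ) σ = fid ρ (Pᴴ * σ * P) := by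
  obtain ⟨K, rfl⟩ := exists_eq_mul_conjTranspose hρ
  obtain ⟨L, rfl⟩ := exists_eq_mul_conjTranspose hσ
  have h1 : P * (K * Kᴴ) * Pᴴ = (P * K) * (P * K)ᴴ := by
    simp [conjTranspose_mul, Matrix.mul_assoc]
  have h2 : Pᴴ * (L * Lᴴ) * P = (Pᴴ * L) * (Pᴴ * L)ᴴ := by
    simp [conjTranspose_mul, Matrix.mul_assoc]
  rw [h1, h2, fid_mul_conjTranspose, fid_mul_conjTranspose, conjTranspose_mul,
    conjTranspose_conjTranspose, Matrix.mul_assoc]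

open scoped Matrix.Norms.L2Operator in
theorem sqrt_mono {A B : Matrix n n ℂ} (h : A ≤ B) : CFC.sqrt A ≤ CFC.sqrt B :=
  CFC.sqrt_le_sqrt A B h

theorem fid_mono_left {ρ ρ' : Matrix n n ℂ} (h : ρ ≤ ρ') (σ : Matrix n n ℂ) :
    fid ρ σ ≤ fid ρ' σ := by
  have := conj_mono h (CFC.sqrt σ)
  rw [conjTranspose_sqrt] at this
  exact trace_re_mono (sqrt_mono this)

theorem fid_mono_right {ρ σ σ' : Matrix n n ℂ} (hρ : ρ.PosSemidef) (hσ : σ.PosSemidef)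
    (h : σ ≤ σ') : fid ρ σ ≤ fid ρ σ' := by
  have hσ' : σ'.PosSemidef := nonneg_iff_posSemidef.1 ((nonneg_iff_posSemidef.2 hσ).trans h)
  rw [fid_comm hρ hσ, fid_comm hρ hσ']
  exact fid_mono_left h ρ

/-- The overlap of two purifications is at most the fidelity. -/
theorem re_trace_le_fid (K L : Matrix n q ℂ) :
    (Lᴴ * K).trace.re ≤ fid (K * Kᴴ) (L * Lᴴ) := by
  rw [fid_mul_conjTranspose]
  simpa using re_trace_le_trNorm (U := (1 : Matrix q q ℂ)) (by simp) (Lᴴ * K)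

/-- Uhlmann's theorem with a purifying system of arbitrary size: the fidelity is attained by the
overlap with a purification of an operator below `σ`. -/
theorem exists_overlap_eq_fid (K : Matrix n q ℂ) {σ : Matrix n n ℂ} (hσ : σ.PosSemidef) :
    ∃ L : Matrix n q ℂ, L * Lᴴ ≤ σ ∧ (Lᴴ * K).trace.re = fid (K * Kᴴ) σ := by
  -- The polar factor `W` of `√σ K` aligns the phases. It is only a contraction, so `√σ W` factors
  -- an operator below `σ`, not necessarily `σ` itself.
  obtain ⟨W, hW, hWM, -⟩ := exists_polar (CFC.sqrt σ * K)
  refine ⟨CFC.sqrt σ * W, ?_, ?_⟩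
  · have := conj_mono (contraction_conjTranspose hW) (CFC.sqrt σ)
    rw [conjTranspose_sqrt, Matrix.mul_one, sqrt_mul_sqrt hσ] at this
    rw [conjTranspose_mul, conjTranspose_sqrt]
    simpa only [Matrix.mul_assoc] using this
  · have h : fid (K * Kᴴ) σ = trNorm (CFC.sqrt σ * K) := by
      have := fid_mul_conjTranspose K (CFC.sqrt σ)
      rwa [conjTranspose_sqrt, sqrt_mul_sqrt hσ] at this
    rw [h, trNorm, ← hWM, conjTranspose_mul, conjTranspose_sqrt, Matrix.mul_assoc]

/-- For a normalized centre the correction term of `genFid` vanishes, so nearness depends on the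
fidelity alone, even across different spaces. -/
theorem mem_epsBall_of_fid_le {ε : ℝ} {ρ σ : Matrix n n ℂ} {ρ' σ' : Matrix p p ℂ}
    (hρ : ρ.trace = 1) (hρ' : ρ'.trace = 1) (hσ : σ ∈ epsBall ε ρ) (hσ' : IsSubDensity σ')
    (h : fid ρ σ ≤ fid ρ' σ') : σ' ∈ epsBall ε ρ' := by
  refine ⟨hσ', le_trans ?_ hσ.2⟩
  have h0 := fid_nonneg ρ σ
  simp only [purifiedDist, genFid, hρ, hρ', Complex.one_re, sub_self, zero_mul, Real.sqrt_zero, add_zero]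
  gcongr

end TraceNorm

/-! ### Duality of min- and max-entropy: convexity, weak and strong inequalities. -/

section Duality

variable {a b c n q : Type*} [Fintype a] [DecidableEq a] [Fintype b] [DecidableEq b]
  [Fintype c] [DecidableEq c] [Fintype n] [DecidableEq n] [Fintype q] [DecidableEq q]

theorem isDensity_ketbra {v : EuclideanSpace ℂ n} (hv : ‖v‖ = 1) : IsDensity (ketbra v) := by
  refine ⟨posSemidef_vecMulVec_self_star _, ?_⟩
  have h : (ketbra v).trace = inner ℂ v v := by
    rw [ketbra, trace_vecMulVec, EuclideanSpace.inner_eq_star_dotProduct]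
  rw [h, inner_self_eq_norm_sq_to_K, hv]
  simp

theorem exists_isDensity (n : Type*) [Fintype n] [DecidableEq n] [Nonempty n] :
    ∃ τ : Matrix n n ℂ, IsDensity τ :=
  ⟨ketbra (EuclideanSpace.single (Classical.arbitrary n) 1), isDensity_ketbra (by simp)⟩

theorem IsDensity.transpose {τ : Matrix n n ℂ} (h : IsDensity τ) : IsDensity τᵀ :=
  ⟨h.1.transpose, by rw [trace_transpose, h.2]⟩

theorem IsDensity.one_kronecker_posSemidef {τ : Matrix b b ℂ} (h : IsDensity τ) :
    ((1 : Matrix a a ℂ) ⊗ₖ τ).PosSemidef :=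
  Matrix.PosSemidef.one.kronecker h.1

/-- A Hermitian operator is bounded by its largest expectation value. -/
theorem le_smul_one_of_density {N : Matrix n n ℂ} (hN : N.IsHermitian) {t : ℝ}
    (h : ∀ τ : Matrix n n ℂ, IsDensity τ → (τ * N).trace.re ≤ t) : N ≤ (t : ℂ) • 1 := by
  have hH : ((t : ℂ) • (1 : Matrix n n ℂ) - N).IsHermitian := by
    refine IsHermitian.sub ?_ hN
    simp [IsHermitian, conjTranspose_smul]
  rw [le_iff]
  refine PosSemidef.of_dotProduct_mulVec_nonneg hH fun x => ?_
  have him := hH.im_star_dotProduct_mulVec_self x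
  rw [Complex.le_def]
  refine ⟨?_, by simpa using him.symm⟩
  by_cases hx : x = 0
  · simp [hx]
  set y : EuclideanSpace ℂ n := WithLp.toLp 2 x
  have hy : y ≠ 0 := fun h0 => hx (by simpa [y] using congrArg WithLp.ofLp h0)
  have hny : ‖y‖ ≠ 0 := norm_ne_zero_iff.2 hy
  have h1 := h _ (isDensity_ketbra (v := ((‖y‖⁻¹ : ℝ) : ℂ) • y) (by
    rw [norm_smul, Complex.norm_real]; simp [hny]))
  have hk : ketbra (((‖y‖⁻¹ : ℝ) : ℂ) • y) = ((‖y‖⁻¹ ^ 2 : ℝ) : ℂ) • vecMulVec x (star x) := by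
    ext i j
    simp [ketbra, vecMulVec_apply, y]
    ring
  have htr : (vecMulVec x (star x) * N).trace = star x ⬝ᵥ (N *ᵥ x) := by
    rw [vecMulVec_mul, trace_vecMulVec, dotProduct_comm, dotProduct_mulVec]
  have hxx : star x ⬝ᵥ x = ((‖y‖ ^ 2 : ℝ) : ℂ) := by
    have := inner_self_eq_norm_sq_to_K (𝕜 := ℂ) y
    rw [EuclideanSpace.inner_eq_star_dotProduct, dotProduct_comm] at this
    simpa [y] using this
  rw [hk, smul_mul, trace_smul, htr, smul_eq_mul, Complex.re_ofReal_mul, inv_pow,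
    inv_mul_le_iff₀ (by positivity)] at h1
  rw [sub_mulVec, dotProduct_sub, smul_mulVec, one_mulVec, dotProduct_smul, hxx, smul_eq_mul,
    ← Complex.ofReal_mul, Complex.sub_re, Complex.ofReal_re, Complex.zero_re]
  linarith

/-- Density operators are the images `K Kᴴ` of the unit sphere of the Hilbert–Schmidt norm, which is
closed and has entries in the unit disc. -/
theorem isCompact_density : IsCompact {τ : Matrix n n ℂ | IsDensity τ} := by
  have hS : IsCompact {K : Matrix n n ℂ | (K * Kᴴ).trace = 1} := by
    have hb : IsCompact {K : n → n → ℂ | ∀ i, K i ∈ {v : n → ℂ | ∀ j, v j ∈ Metric.closedBall 0 1}} :=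
      isCompact_pi_infinite fun _ => isCompact_pi_infinite fun _ => isCompact_closedBall 0 1
    refine IsCompact.of_isClosed_subset (s := (show Set (Matrix n n ℂ) from
      {K : n → n → ℂ | ∀ i, K i ∈ {v : n → ℂ | ∀ j, v j ∈ Metric.closedBall 0 1}})) hb ?_ ?_
    · exact isClosed_eq (by fun_prop) continuous_const
    · intro K hK i j
      have h1 : (K * Kᴴ).trace.re = ∑ i, ∑ j, ‖K i j‖ ^ 2 := by
        simp [trace, mul_apply, Complex.mul_conj, Complex.normSq_eq_norm_sq, -Complex.ofReal_pow]
      have h2 : ‖K i j‖ ^ 2 ≤ 1 := by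
        have : (K * Kᴴ).trace.re = 1 := by rw [hK]; rfl
        rw [← this, h1]
        exact (Finset.single_le_sum (f := fun j => ‖K i j‖ ^ 2) (fun _ _ => by positivity)
          (Finset.mem_univ j)).trans
          (Finset.single_le_sum (f := fun i => ∑ j, ‖K i j‖ ^ 2)
            (fun _ _ => Finset.sum_nonneg fun _ _ => by positivity) (Finset.mem_univ i))
      rw [mem_closedBall_zero_iff]
      exact (sq_le_one_iff₀ (norm_nonneg _)).1 h2
  have : {τ : Matrix n n ℂ | IsDensity τ} = (fun K : Matrix n n ℂ => K * Kᴴ) ''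
      {K | (K * Kᴴ).trace = 1} := by
    ext τ
    constructor
    · rintro ⟨h1, h2⟩
      obtain ⟨K, rfl⟩ := exists_eq_mul_conjTranspose h1
      exact ⟨K, h2, rfl⟩
    · rintro ⟨K, h, rfl⟩
      exact ⟨posSemidef_self_mul_conjTranspose K, h⟩
  rw [this]
  exact hS.image (by fun_prop)

theorem convex_density : Convex ℝ {τ : Matrix n n ℂ | IsDensity τ} := by
  rintro x ⟨hx, hx'⟩ y ⟨hy, hy'⟩ s t hs ht hst
  refine ⟨(hx.smul hs).add (hy.smul ht), ?_⟩
  rw [trace_add, trace_smul, trace_smul, hx', hy']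
  simp only [Complex.real_smul, mul_one]
  exact_mod_cast hst

theorem isClosed_posSemidef : IsClosed {A : Matrix n n ℂ | A.PosSemidef} := by
  have : {A : Matrix n n ℂ | A.PosSemidef} = {A | Aᴴ = A} ∩
      ⋂ x : n → ℂ, {A | 0 ≤ star x ⬝ᵥ (A *ᵥ x)} := by
    ext A
    simp only [posSemidef_iff_dotProduct_mulVec, Set.mem_ofPred_eq, Set.mem_inter_iff,
      Set.mem_iInter, IsHermitian]
  rw [this]
  refine (isClosed_eq (by fun_prop) continuous_id).inter (isClosed_iInter fun x => ?_)
  exact isClosed_le continuous_const (by fun_prop)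

/-- A real linear functional on matrices is, on Hermitian arguments, the pairing with a Hermitian
matrix. -/
theorem exists_hermitian_repr (f : Matrix n n ℂ →ₗ[ℝ] ℝ) :
    ∃ E : Matrix n n ℂ, E.IsHermitian ∧
      ∀ H : Matrix n n ℂ, H.IsHermitian → f H = (E * H).trace.re := by
  -- A real linear functional on `ℂ` is `z ↦ Re ((f 1 - i f i) z)`; this is applied entrywise.
  set G : Matrix n n ℂ := Matrix.of fun j i =>
    (f (single i j 1) : ℂ) - Complex.I * f (single i j Complex.I)
  have hG : ∀ H : Matrix n n ℂ, f H = (G * H).trace.re := by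
    intro H
    conv_lhs => rw [matrix_eq_sum_single H]
    have hs : ∀ i j, f (single i j (H i j)) = (G j i * H i j).re := by
      intro i j
      have : single i j (H i j) = (H i j).re • single i j (1 : ℂ)
          + (H i j).im • single i j Complex.I := by
        rw [smul_single, smul_single, ← single_add]
        congr 1
        apply Complex.ext <;> simp
      rw [this, map_add, map_smul, map_smul]
      simp [G]
      ring
    simp only [map_sum, hs, trace, diag_apply, mul_apply, Complex.re_sum]
    exact Finset.sum_comm
  refine ⟨(1 / 2 : ℝ) • (G + Gᴴ), ?_, fun H hH => ?_⟩
  · simp [IsHermitian, conjTranspose_smul, add_comm]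
  · have h1 : (Gᴴ * H).trace.re = (G * H).trace.re := by
      rw [re_trace_conjTranspose_comm, hH.eq, Matrix.trace_mul_comm]
    rw [hG, smul_mul, Matrix.add_mul, trace_smul, trace_add, Complex.smul_re, Complex.add_re, h1]
    simp
    ring

theorem posSemidef_of_re_trace_nonneg {E : Matrix n n ℂ} (hE : E.IsHermitian)
    (h : ∀ P : Matrix n n ℂ, P.PosSemidef → 0 ≤ (E * P).trace.re) : E.PosSemidef := by
  have := le_smul_one_of_density (N := -E) (t := 0) hE.neg fun τ hτ => by
    have := h τ hτ.1
    rw [Matrix.trace_mul_comm] at this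
    simpa using this
  simpa [le_iff] using this

/-- Separation: if `A` lies below no multiple `lam • (1 ⊗ τ)`, some positive `E` witnesses it
uniformly in `τ`. -/
theorem exists_separating {A : Matrix (a × b) (a × b) ℂ} (hA : A.PosSemidef) (lam : ℝ≥0)
    (h : ∀ τ : Matrix b b ℂ, IsDensity τ → ¬ A ≤ (lam : ℂ) • ((1 : Matrix a a ℂ) ⊗ₖ τ)) :
    ∃ E : Matrix (a × b) (a × b) ℂ, E.PosSemidef ∧ ∀ τ : Matrix b b ℂ, IsDensity τ →
      lam * (E * ((1 : Matrix a a ℂ) ⊗ₖ τ)).trace.re < (E * A).trace.re := by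
  have : LocallyConvexSpace ℝ (Matrix (a × b) (a × b) ℂ) :=
    inferInstanceAs (LocallyConvexSpace ℝ (a × b → a × b → ℂ))
  set g : Matrix b b ℂ → Matrix (a × b) (a × b) ℂ := fun τ =>
    (lam : ℂ) • ((1 : Matrix a a ℂ) ⊗ₖ τ) - A with hg
  have hgc : Continuous g := by
    have hk : Continuous fun τ : Matrix b b ℂ => (1 : Matrix a a ℂ) ⊗ₖ τ := by
      refine continuous_matrix fun i j => ?_
      simp only [kroneckerMap_apply]
      fun_prop
    exact (hk.const_smul (lam : ℂ)).sub continuous_const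
  have hconv : Convex ℝ (g '' {τ | IsDensity τ}) := by
    rintro _ ⟨x, hx, rfl⟩ _ ⟨y, hy, rfl⟩ s t hs ht hst
    refine ⟨s • x + t • y, convex_density hx hy hs ht hst, ?_⟩
    have hA' : A = s • A + t • A := by rw [← add_smul, hst, one_smul]
    simp only [hg]
    conv_lhs => rw [hA']
    rw [kronecker_add, kronecker_smul, kronecker_smul, smul_add, smul_sub, smul_sub,
      smul_comm (lam : ℂ) s, smul_comm (lam : ℂ) t]
    abel
  have hconv' : Convex ℝ {P : Matrix (a × b) (a × b) ℂ | P.PosSemidef} := by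
    rintro x hx y hy s t hs ht -
    exact (hx.smul hs).add (hy.smul ht)
  have hdisj : Disjoint (g '' {τ | IsDensity τ})
      {P : Matrix (a × b) (a × b) ℂ | P.PosSemidef} := by
    rw [Set.disjoint_left]
    rintro _ ⟨τ, hτ, rfl⟩ hP
    exact h τ hτ (le_iff.2 hP)
  -- The compact convex set `{lam • (1 ⊗ τ) - A}` misses the closed cone of positive operators.
  -- Since `0` is in the cone, `v < 0`.
  obtain ⟨f, u, v, hfu, huv, hfv⟩ := geometric_hahn_banach_compact_closed hconv
    (isCompact_density.image hgc) hconv' isClosed_posSemidef hdisj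
  obtain ⟨E, hE, hEf⟩ := exists_hermitian_repr f.toLinearMap
  have hv0 : v < 0 := by simpa using hfv 0 PosSemidef.zero
  refine ⟨E, posSemidef_of_re_trace_nonneg hE fun P hP => ?_, fun τ hτ => ?_⟩
  · by_contra! hneg
    rw [← hEf P hP.isHermitian] at hneg
    -- If `f P < 0`, scaling `P` inside the cone makes `f` equal to `v`, contradicting the strict
    -- bound.
    have hr : 0 ≤ v / f P := div_nonneg_of_nonpos hv0.le hneg.le
    have := hfv _ (hP.smul hr)
    rw [map_smul, smul_eq_mul] at this
    exact this.ne' (div_mul_cancel₀ v hneg.ne)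
  · have h1 := hfu _ ⟨τ, hτ, rfl⟩
    have hherm : (g τ).IsHermitian := by
      refine IsHermitian.sub ?_ hA.isHermitian
      have := (hτ.one_kronecker_posSemidef (a := a)).isHermitian
      simp [IsHermitian, conjTranspose_smul, this.eq]
    have h2 := hEf _ hherm
    change f (g τ) = _ at h2
    rw [h2] at h1
    simp only [hg, Matrix.mul_sub, trace_sub, Matrix.mul_smul, trace_smul, Complex.sub_re,
      smul_eq_mul] at h1
    rw [show ((lam : ℂ)) = ((lam : ℝ) : ℂ) from rfl, Complex.re_ofReal_mul] at h1
    linarith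

/-- Regrouping of a tripartite vector, read as a matrix. -/
def regroup (K : Matrix (a × b) c ℂ) : Matrix (a × c) b ℂ :=
  Matrix.of fun p j => K (p.1, j) p.2

@[simp] theorem regroup_regroup (K : Matrix (a × b) c ℂ) : regroup (regroup K) = K := rfl

theorem trace_regroup (K L : Matrix (a × b) c ℂ) :
    ((regroup L)ᴴ * regroup K).trace = (Lᴴ * K).trace := by
  simp only [trace, diag_apply, mul_apply, conjTranspose_apply, regroup, of_apply,
    Fintype.sum_prod_type]
  rw [Finset.sum_comm]
  simp_rw [Finset.sum_comm (s := (Finset.univ : Finset b))]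
  rw [Finset.sum_comm]

/-- Acting with `T` on the system `c` of the regrouped vector is right multiplication of `L` by
`Tᵀ`. This identity moves all traces between the two bipartitions and is the source of the
transposes below. -/
theorem trace_one_kronecker_regroup (W : Matrix (a × c) b ℂ) (T : Matrix c c ℂ)
    (L : Matrix (a × b) c ℂ) :
    (Wᴴ * (((1 : Matrix a a ℂ) ⊗ₖ T) * regroup L)).trace = (Tᵀ * ((regroup W)ᴴ * L)).trace := by
  have e : ((1 : Matrix a a ℂ) ⊗ₖ T) * regroup L = regroup (L * Tᵀ) := by
    ext ⟨i, k⟩ j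
    simp [mul_apply, regroup, Fintype.sum_prod_type, one_apply, mul_comm]
  have h := trace_regroup (L * Tᵀ) (regroup W)
  rw [regroup_regroup] at h
  rw [e, h, ← Matrix.mul_assoc, Matrix.trace_mul_comm]

/-- Cauchy–Schwarz for the Hilbert–Schmidt product, from the discriminant of `t ↦ ‖t A + B‖²`. -/
theorem re_trace_sq_le (A B : Matrix n q ℂ) :
    (Aᴴ * B).trace.re ^ 2 ≤ (Aᴴ * A).trace.re * (Bᴴ * B).trace.re := by
  have h : ∀ t : ℝ, 0 ≤ (Aᴴ * A).trace.re * (t * t) + (2 * (Aᴴ * B).trace.re) * t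
      + (Bᴴ * B).trace.re := by
    intro t
    have h0 := trace_re_nonneg (posSemidef_conjTranspose_mul_self ((t : ℂ) • A + B))
    have hc := re_trace_conjTranspose_comm A B
    simp only [conjTranspose_add, conjTranspose_smul, Matrix.add_mul, Matrix.mul_add,
      Matrix.smul_mul, Matrix.mul_smul, trace_add, trace_smul, Complex.add_re, smul_eq_mul,
      Complex.star_def, Complex.conj_ofReal, Complex.re_ofReal_mul, ← hc] at h0
    nlinarith
  have := discrim_le_zero h
  simp only [discrim] at this
  nlinarith

theorem one_kronecker_mul_conjTranspose (T : Matrix b b ℂ) :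
    (1 : Matrix a a ℂ) ⊗ₖ (T * Tᴴ) = ((1 : Matrix a a ℂ) ⊗ₖ T) * ((1 : Matrix a a ℂ) ⊗ₖ T)ᴴ := by
  rw [conjTranspose_kronecker, conjTranspose_one, ← mul_kronecker_mul, Matrix.mul_one]

/-- Weak duality between min- and max-entropy. -/
theorem fid_sq_le_of_le (L : Matrix (a × b) c ℂ) {τb : Matrix b b ℂ} (hb : IsDensity τb)
    {τc : Matrix c c ℂ} (hc : IsDensity τc) {lam : ℝ≥0}
    (h : L * Lᴴ ≤ (lam : ℂ) • ((1 : Matrix a a ℂ) ⊗ₖ τb)) :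
    fid ((1 : Matrix a a ℂ) ⊗ₖ τc) (regroup L * (regroup L)ᴴ) ^ 2 ≤ lam := by
  set T := CFC.sqrt τc
  have hT : Tᴴ = T := conjTranspose_sqrt _
  have hTT : τc = T * Tᴴ := by rw [hT]; exact (sqrt_mul_sqrt hc.1).symm
  have hTs : Tᵀᴴ = Tᵀ := IsHermitian.transpose hT
  have hTt : Tᵀ * Tᵀ = τcᵀ := by
    rw [hTT, transpose_mul, hT]
  rw [fid_comm hc.one_kronecker_posSemidef (posSemidef_self_mul_conjTranspose _), hTT,
    one_kronecker_mul_conjTranspose, fid_mul_conjTranspose, conjTranspose_kronecker,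
    conjTranspose_one, hT]
  obtain ⟨W, hW, hWM, -⟩ := exists_polar (((1 : Matrix a a ℂ) ⊗ₖ T) * regroup L)
  rw [trNorm, ← hWM, trace_one_kronecker_regroup]
  set B := (regroup W)ᴴ * L with hB
  -- The fidelity is now `Tr (Tᵀ B)` and `Tr (Tᵀ Tᵀ) = Tr τcᵀ = 1`, so it remains to show `Tr (Bᴴ B)
  -- ≤ lam`.
  have h1 := re_trace_sq_le Tᵀ B
  rw [hTs, hTt, hc.transpose.2, Complex.one_re, one_mul] at h1
  refine h1.trans ?_
  have h2 : (Bᴴ * B).trace = ((regroup W)ᴴ * (L * Lᴴ) * regroup W).trace := by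
    rw [Matrix.trace_mul_comm, hB, conjTranspose_mul, conjTranspose_conjTranspose]
    simp only [Matrix.mul_assoc]
  have h3 := trace_re_mono (conj_mono' h (regroup W))
  have h4 : ((regroup W)ᴴ * ((lam : ℂ) • ((1 : Matrix a a ℂ) ⊗ₖ τb)) * regroup W).trace.re
      = lam * (τbᵀ * (Wᴴ * W)).trace.re := by
    rw [Matrix.mul_smul, smul_mul, Matrix.mul_assoc, trace_smul, trace_one_kronecker_regroup,
      regroup_regroup, smul_eq_mul]
    exact Complex.re_ofReal_mul _ _
  have h5 := trace_mul_re_mono hW hb.transpose.1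
  rw [Matrix.mul_one, hb.transpose.2, Complex.one_re] at h5
  rw [h2]
  refine h3.trans (h4.le.trans ?_)
  nlinarith [lam.2]

/-- Strong duality between min- and max-entropy. -/
theorem exists_le_or_le_fid_sq [Nonempty b] (L : Matrix (a × b) c ℂ) {lam : ℝ≥0} (hlam : 0 < lam) :
    (∃ τb : Matrix b b ℂ, IsDensity τb ∧ L * Lᴴ ≤ (lam : ℂ) • ((1 : Matrix a a ℂ) ⊗ₖ τb)) ∨
    ∃ τc : Matrix c c ℂ, IsDensity τc ∧
      lam ≤ fid ((1 : Matrix a a ℂ) ⊗ₖ τc) (regroup L * (regroup L)ᴴ) ^ 2 := by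
  rw [or_iff_not_imp_left]
  intro hno
  push Not at hno
  -- The witness `E` will yield the optimal `τc`: it is chosen so that the Cauchy–Schwarz step of
  -- weak duality becomes an equality.
  obtain ⟨E, hE, hsep⟩ := exists_separating (posSemidef_self_mul_conjTranspose L) lam hno
  have hl : (0 : ℝ) < lam := hlam
  set κ := (E * (L * Lᴴ)).trace.re with hκ
  obtain ⟨τ₀, hτ₀⟩ := exists_isDensity b
  have hκ0 : 0 < κ := by
    refine lt_of_le_of_lt (mul_nonneg hl.le ?_) (hsep τ₀ hτ₀)
    have := trace_mul_re_mono (nonneg_iff_posSemidef.2 (hτ₀.one_kronecker_posSemidef (a := a))) hE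
    simpa using this
  set R := CFC.sqrt E
  have hRh : Rᴴ = R := conjTranspose_sqrt _
  have hRR : R * R = E := sqrt_mul_sqrt hE
  obtain ⟨U, hU, hUS, -⟩ := exists_polar (R * L)
  set S := CFC.sqrt ((R * L)ᴴ * (R * L)) with hSdef
  have hSh : Sᴴ = S := conjTranspose_sqrt _
  have hSS : (S * S).trace.re = κ := by
    rw [sqrt_mul_sqrt (posSemidef_conjTranspose_mul_self _), conjTranspose_mul, hRh, hκ, ← hRR,
      Matrix.mul_assoc, Matrix.trace_mul_comm]
    simp only [Matrix.mul_assoc]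
  have hSStr : (S * S).trace = (κ : ℂ) := by
    have : (S * S).PosSemidef := by
      simpa [hSh] using posSemidef_conjTranspose_mul_self S
    rw [← hSS]
    exact Complex.ext rfl (Complex.le_def.1 this.trace_nonneg).2.symm
  set W := R * U with hW
  have hWL : Wᴴ * L = S := by
    rw [hW, conjTranspose_mul, hRh, Matrix.mul_assoc, hUS]
  have hWW : W * Wᴴ ≤ E := by
    have := conj_mono (contraction_conjTranspose hU) R
    rw [hRh, Matrix.mul_one, hRR] at this
    rw [hW, conjTranspose_mul, hRh]
    simpa only [Matrix.mul_assoc] using this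
  -- Pairing with a density operator `τ` gives `Tr ((1 ⊗ τᵀ) W Wᴴ) ≤ Tr (E (1 ⊗ τᵀ))`, which the
  -- separation bounds by `κ / lam`.
  have hN : (regroup W)ᴴ * regroup W ≤ ((κ / lam : ℝ) : ℂ) • 1 := by
    refine le_smul_one_of_density (posSemidef_conjTranspose_mul_self _).isHermitian fun τ hτ => ?_
    have h1 := trace_one_kronecker_regroup W τᵀ (regroup W)
    rw [transpose_transpose, regroup_regroup] at h1
    rw [← h1, ← Matrix.mul_assoc, Matrix.mul_assoc, Matrix.trace_mul_comm, Matrix.mul_assoc]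
    refine (trace_mul_re_mono hWW hτ.transpose.one_kronecker_posSemidef).trans ?_
    rw [Matrix.trace_mul_comm, le_div_iff₀ hl, mul_comm]
    exact (hsep _ hτ.transpose).le
  set s := √κ
  have hs : s * s = κ := Real.mul_self_sqrt hκ0.le
  have hs0 : 0 < s := Real.sqrt_pos.2 hκ0
  set r := √(lam / κ)
  have hr : r * r = lam / κ := Real.mul_self_sqrt (by positivity)
  -- `Tᵀ` is proportional to `Wᴴ L = S`, and `Tr S² = κ = s²` normalizes `T Tᴴ`.
  set T := ((s⁻¹ : ℝ) : ℂ) • Sᵀ with hT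
  have hTh : Tᴴ = T := by
    rw [hT, conjTranspose_smul, IsHermitian.transpose hSh]; simp
  refine ⟨T * Tᴴ, ⟨posSemidef_self_mul_conjTranspose _, ?_⟩, ?_⟩
  · rw [hTh, hT, smul_mul, Matrix.mul_smul, ← transpose_mul, trace_smul, trace_smul,
      trace_transpose, hSStr, smul_eq_mul, smul_eq_mul, ← Complex.ofReal_mul, ← Complex.ofReal_mul,
      ← hs]
    have : s⁻¹ * (s⁻¹ * (s * s)) = 1 := by field_simp
    rw [this]; simp
  have hfid : fid ((1 : Matrix a a ℂ) ⊗ₖ (T * Tᴴ)) (regroup L * (regroup L)ᴴ)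
      = trNorm (((1 : Matrix a a ℂ) ⊗ₖ T) * regroup L) := by
    rw [fid_comm (Matrix.PosSemidef.one.kronecker (posSemidef_self_mul_conjTranspose _))
      (posSemidef_self_mul_conjTranspose _), one_kronecker_mul_conjTranspose,
      fid_mul_conjTranspose, conjTranspose_kronecker, conjTranspose_one, hTh]
  rw [hfid]
  -- `r = √(lam / κ)` is the scaling at which the bound `hN` makes `r • regroup W` a contraction;
  -- its overlap with `(1 ⊗ T) regroup L` is `r s = √lam`.
  have hV : ((r : ℂ) • regroup W)ᴴ * ((r : ℂ) • regroup W) ≤ 1 := by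
    have h2 := (le_iff.1 hN).smul (show (0 : ℝ) ≤ lam / κ by positivity)
    rw [le_iff]
    convert h2 using 1
    rw [conjTranspose_smul, smul_mul, Matrix.mul_smul, smul_sub, smul_smul, Complex.star_def,
      Complex.conj_ofReal, ← Complex.ofReal_mul, hr, ← Complex.coe_smul, ← Complex.coe_smul,
      smul_smul, ← Complex.ofReal_mul,
      show (lam / κ) * (κ / lam) = 1 by field_simp]
    simp
  have h3 := re_trace_le_trNorm hV (((1 : Matrix a a ℂ) ⊗ₖ T) * regroup L)
  have h4 : (((r : ℂ) • regroup W)ᴴ * (((1 : Matrix a a ℂ) ⊗ₖ T) * regroup L)).trace.re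
      = r * s := by
    rw [conjTranspose_smul, smul_mul, trace_smul, trace_one_kronecker_regroup, regroup_regroup,
      hWL, hT, transpose_smul, transpose_transpose, smul_mul, trace_smul, hSStr, smul_eq_mul,
      smul_eq_mul, Complex.star_def, Complex.conj_ofReal, ← Complex.ofReal_mul,
      ← Complex.ofReal_mul, Complex.ofReal_re, ← hs]
    field_simp
  rw [h4] at h3
  have h5 : (lam : ℝ) = (r * s) ^ 2 := by
    have : (r * s) ^ 2 = (r * r) * (s * s) := by ring
    rw [this, hr, hs]; field_simp
  rw [h5]
  gcongr

end Duality

/-! ### Duality after smoothing. -/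

section SmoothDuality

variable {a b c n : Type*} [Fintype a] [DecidableEq a] [Fintype b] [DecidableEq b]
  [Fintype c] [DecidableEq c] [Fintype n] [DecidableEq n]

/-- The operators `1 ⊗ τ` with `τ` a density operator. -/
def oneTensor : Set (Matrix (a × b) (a × b) ℂ) :=
  {σ | ∃ τ : Matrix b b ℂ, IsDensity τ ∧ σ = (1 : Matrix a a ℂ) ⊗ₖ τ}

theorem dFid_eq (P Q : Matrix n n ℂ) :
    dFid P Q = -ENNReal.log (ENNReal.ofReal (fid Q P ^ 2)) := by
  rw [dFid, ENNReal.ofReal_pow (fid_nonneg _ _), ENNReal.log_pow]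
  norm_num

theorem dMax_mono_left {P P' : Matrix n n ℂ} (h : P ≤ P') (Q : Matrix n n ℂ) :
    dMax P Q ≤ dMax P' Q :=
  le_iInf₂ fun lam hlam => iInf₂_le lam (h.trans hlam)

theorem dMax_anti_right (P : Matrix n n ℂ) {Q Q' : Matrix n n ℂ} (h : Q ≤ Q') :
    dMax P Q' ≤ dMax P Q := by
  refine le_iInf₂ fun lam hlam => iInf₂_le lam (hlam.trans ?_)
  rw [le_iff, ← smul_sub]
  exact (le_iff.1 h).smul (show (0 : ℂ) ≤ (lam : ℂ) from Complex.zero_le_real.2 lam.2)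

theorem dMax_conj_le (P Q C : Matrix n n ℂ) : dMax (C * P * Cᴴ) (C * Q * Cᴴ) ≤ dMax P Q := by
  refine le_iInf₂ fun lam hlam => iInf₂_le lam ?_
  have := conj_mono hlam C
  rwa [Matrix.mul_smul, smul_mul] at this

theorem dFid_le_of_fid_le {m : Type*} [Fintype m] [DecidableEq m] {P Q : Matrix n n ℂ}
    {P' Q' : Matrix m m ℂ} (h : fid Q P ≤ fid Q' P') : dFid P' Q' ≤ dFid P Q := by
  rw [dFid_eq, dFid_eq, EReal.neg_le_neg_iff]
  have := fid_nonneg Q P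
  gcongr

theorem condEntropy_eq_neg_distTo
    (D : Matrix (a × b) (a × b) ℂ → Matrix (a × b) (a × b) ℂ → EReal)
    (ρ : Matrix (a × b) (a × b) ℂ) : condEntropy D ρ = -distTo D oneTensor ρ := by
  refine le_antisymm (iSup₂_le fun τ hτ => ?_) (EReal.neg_le.1 (le_iInf₂ ?_))
  · exact EReal.neg_le_neg_iff.2 (iInf₂_le _ ⟨τ, hτ, rfl⟩)
  · rintro _ ⟨τ, hτ, rfl⟩
    exact EReal.neg_le.1 (le_iSup₂ (f := fun (τ : Matrix b b ℂ) (_ : IsDensity τ) =>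
      -D ρ ((1 : Matrix a a ℂ) ⊗ₖ τ)) τ hτ)

theorem distTo_mono {D : Matrix n n ℂ → Matrix n n ℂ → EReal} {S : Set (Matrix n n ℂ)}
    {ρ ρ' : Matrix n n ℂ} (h : ∀ σ ∈ S, D ρ σ ≤ D ρ' σ) : distTo D S ρ ≤ distTo D S ρ' :=
  iInf₂_mono h

/-- Duality of min- and max-entropy for pure states. -/
theorem condEntropy_dFid_regroup [Nonempty b] (L : Matrix (a × b) c ℂ) :
    condEntropy dFid (regroup L * (regroup L)ᴴ) = distTo dMax oneTensor (L * Lᴴ) := by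
  refine le_antisymm (iSup₂_le fun τc hc => le_iInf₂ ?_) ?_
  · rintro _ ⟨τb, hb, rfl⟩
    refine le_iInf₂ fun lam hlam => ?_
    rw [dFid_eq, neg_neg]
    refine ENNReal.log_monotone ?_
    rw [ENNReal.ofReal_le_coe]
    exact fid_sq_le_of_le L hb hc hlam
  · by_contra! hlt
    -- A value `log x` strictly inside the supposed gap has `0 < x < ∞`, and either alternative of
    -- strong duality at `x` closes the gap.
    obtain ⟨z, hz1, hz2⟩ := exists_between hlt
    obtain ⟨x, rfl⟩ := ENNReal.log_surjective z
    have hx0 : x ≠ 0 := by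
      rintro rfl
      simp at hz1
    have hxt : x ≠ ⊤ := by
      rintro rfl
      simp at hz2
    lift x to ℝ≥0 using hxt
    have hx : 0 < x := pos_iff_ne_zero.2 (by exact_mod_cast hx0)
    rcases exists_le_or_le_fid_sq L hx with ⟨τ, hτ, h⟩ | ⟨τ, hτ, h⟩
    · exact absurd hz2 (not_lt.2 ((iInf₂_le (_ : Matrix (a × b) (a × b) ℂ) ⟨τ, hτ, rfl⟩).trans
        (iInf₂_le x h)))
    · refine absurd hz1 (not_lt.2 (le_trans ?_ (le_iSup₂
        (f := fun (τ : Matrix c c ℂ) (_ : IsDensity τ) =>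
          -dFid (regroup L * (regroup L)ᴴ) ((1 : Matrix a a ℂ) ⊗ₖ τ)) τ hτ)))
      rw [dFid_eq, neg_neg]
      refine ENNReal.log_monotone ?_
      rw [← ENNReal.ofReal_coe_nnreal]
      exact ENNReal.ofReal_le_ofReal h

theorem condEntropy_dMax_eq [Nonempty b] (L : Matrix (a × b) c ℂ) :
    condEntropy dMax (L * Lᴴ) = distTo dFid oneTensor (regroup L * (regroup L)ᴴ) := by
  rw [condEntropy_eq_neg_distTo, ← condEntropy_dFid_regroup, condEntropy_eq_neg_distTo, neg_neg]

theorem trace_regroup_self (K : Matrix (a × b) c ℂ) :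
    (regroup K * (regroup K)ᴴ).trace = (K * Kᴴ).trace := by
  rw [Matrix.trace_mul_comm, trace_regroup, Matrix.trace_mul_comm]

/-- A nearby operator on one marginal of a pure state dominates the marginal of a pure state whose
complementary marginal is equally near. -/
theorem exists_regroup_mem_epsBall {ε : ℝ} {K : Matrix (a × b) c ℂ} (hK : (K * Kᴴ).trace = 1)
    {σ : Matrix (a × b) (a × b) ℂ} (hσ : σ ∈ epsBall ε (K * Kᴴ)) :
    ∃ L : Matrix (a × b) c ℂ, L * Lᴴ ≤ σ ∧
      regroup L * (regroup L)ᴴ ∈ epsBall ε (regroup K * (regroup K)ᴴ) := by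
  -- `L` keeps the full fidelity as an overlap with `K`. Overlaps are invariant under regrouping and
  -- bound the fidelity of the other marginals from below.
  obtain ⟨L, hL, hLK⟩ := exists_overlap_eq_fid K hσ.1.1
  refine ⟨L, hL, mem_epsBall_of_fid_le hK ((trace_regroup_self K).trans hK) hσ
    ⟨posSemidef_self_mul_conjTranspose _, ?_⟩ ?_⟩
  · rw [trace_regroup_self]
    exact (trace_re_mono hL).trans hσ.1.2
  · rw [← hLK, ← trace_regroup]
    exact re_trace_le_fid _ _

theorem distTo_dMax_mono {S : Set (Matrix n n ℂ)} {ρ ρ' : Matrix n n ℂ} (h : ρ ≤ ρ') :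
    distTo dMax S ρ ≤ distTo dMax S ρ' :=
  distTo_mono fun σ _ => dMax_mono_left h σ

theorem distTo_dFid_anti {S : Set (Matrix n n ℂ)} (hS : ∀ σ ∈ S, σ.PosSemidef)
    {ρ ρ' : Matrix n n ℂ} (hρ : ρ.PosSemidef) (h : ρ ≤ ρ') :
    distTo dFid S ρ' ≤ distTo dFid S ρ :=
  distTo_mono fun σ hσ => dFid_le_of_fid_le (fid_mono_right (hS σ hσ) hρ h)

theorem posSemidef_of_mem_oneTensor {σ : Matrix (a × b) (a × b) ℂ} (h : σ ∈ oneTensor) :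
    σ.PosSemidef := by
  obtain ⟨τ, hτ, rfl⟩ := h
  exact hτ.one_kronecker_posSemidef

/-- Duality of smooth min- and max-entropy. -/
theorem smoothHMin_eq [Nonempty b] {K : Matrix (a × b) c ℂ} (hK : (K * Kᴴ).trace = 1) (ε : ℝ) :
    smoothHMin ε (K * Kᴴ)
      = smoothSup ε (distTo dFid oneTensor) (regroup K * (regroup K)ᴴ) := by
  refine le_antisymm (iSup₂_le fun σ hσ => ?_) (iSup₂_le fun σ hσ => ?_)
  -- The system `c` may be too small to purify `σ`; replacing `σ` by the smaller `L Lᴴ` only raises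
  -- the min-entropy.
  · obtain ⟨L, hL, hLb⟩ := exists_regroup_mem_epsBall hK hσ
    refine le_trans ?_ (le_iSup₂ (f := fun σ (_ : σ ∈ epsBall ε _) => distTo dFid oneTensor σ)
      _ hLb)
    rw [← condEntropy_dMax_eq, condEntropy_eq_neg_distTo, condEntropy_eq_neg_distTo,
      EReal.neg_le_neg_iff]
    exact distTo_dMax_mono hL
  · obtain ⟨L, hL, hLb⟩ := exists_regroup_mem_epsBall (by rw [trace_regroup_self, hK]) hσ
    refine le_trans ?_ (le_iSup₂ (f := fun σ (_ : σ ∈ epsBall ε _) => condEntropy dMax σ) _ hLb)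
    rw [condEntropy_dMax_eq]
    exact distTo_dFid_anti (fun _ => posSemidef_of_mem_oneTensor)
      (posSemidef_self_mul_conjTranspose _) hL

theorem smoothHMax_eq [Nonempty c] {K : Matrix (a × b) c ℂ} (hK : (K * Kᴴ).trace = 1) (ε : ℝ) :
    smoothHMax ε (K * Kᴴ)
      = smoothInf ε (distTo dMax oneTensor) (regroup K * (regroup K)ᴴ) := by
  refine le_antisymm (le_iInf₂ fun σ hσ => ?_) (le_iInf₂ fun σ hσ => ?_)
  · obtain ⟨L, hL, hLb⟩ := exists_regroup_mem_epsBall (by rw [trace_regroup_self, hK]) hσ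
    refine le_trans (iInf₂_le _ hLb) ?_
    rw [condEntropy_dFid_regroup]
    exact distTo_dMax_mono hL
  · obtain ⟨L, hL, hLb⟩ := exists_regroup_mem_epsBall hK hσ
    refine le_trans (iInf₂_le _ hLb) ?_
    rw [← condEntropy_dFid_regroup, condEntropy_eq_neg_distTo, condEntropy_eq_neg_distTo,
      EReal.neg_le_neg_iff]
    exact distTo_dFid_anti (fun _ => posSemidef_of_mem_oneTensor)
      (posSemidef_self_mul_conjTranspose _) hL

end SmoothDuality

/-! ### Classes of states compared with the operators `1 ⊗ τ`. -/

section Classes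

variable {a b ι : Type*} [Fintype a] [DecidableEq a] [Fintype b] [DecidableEq b] [Fintype ι]

theorem IsDensity.le_one {n : Type*} [Fintype n] [DecidableEq n] {A : Matrix n n ℂ}
    (hA : IsDensity A) : A ≤ 1 := by
  have hH := hA.1.isHermitian
  have h1 : ∑ i, hH.eigenvalues i = 1 := by
    have h := hH.trace_eq_sum_eigenvalues
    rw [hA.2] at h
    exact Complex.ofReal_injective (by simpa using h.symm)
  rw [← cfc_id' ℝ A hH.isSelfAdjoint]
  refine cfc_le_one _ _ fun x hx => ?_
  rw [hH.spectrum_real_eq_range_eigenvalues] at hx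
  obtain ⟨i, rfl⟩ := hx
  rw [← h1]
  exact Finset.single_le_sum (fun i _ => hA.1.eigenvalues_nonneg i) (Finset.mem_univ i)

theorem mem_Sep_of_fintype (p : ι → ℝ) (A : ι → Matrix a a ℂ) (B : ι → Matrix b b ℂ)
    (hp : ∀ j, 0 ≤ p j) (hp1 : ∑ j, p j = 1) (hA : ∀ j, IsDensity (A j))
    (hB : ∀ j, IsDensity (B j)) : ∑ j, (p j : ℂ) • (A j ⊗ₖ B j) ∈ Sep := by
  let f := (Fintype.equivFin ι).symm
  refine ⟨Fintype.card ι, p ∘ f, A ∘ f, B ∘ f, fun _ => hp _, ?_, fun _ => hA _, fun _ => hB _, ?_⟩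
  · rw [← hp1]; exact f.sum_comp p
  · exact (f.sum_comp fun j => (p j : ℂ) • (A j ⊗ₖ B j)).symm

theorem isDensity_basis {n : Type*} [Fintype n] [DecidableEq n]
    (u : OrthonormalBasis n ℂ (EuclideanSpace ℂ n)) (i : n) : IsDensity (ketbra (u i)) :=
  isDensity_ketbra (u.orthonormal.1 i)

theorem CQ_subset_Sep : (CQ : Set (Matrix (a × b) (a × b) ℂ)) ⊆ Sep := by
  rintro _ ⟨u, p, B, hp, hp1, hB, rfl⟩
  exact mem_Sep_of_fintype p _ B hp hp1 (isDensity_basis u) hB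

theorem QC_subset_Sep : (QC : Set (Matrix (a × b) (a × b) ℂ)) ⊆ Sep := by
  rintro _ ⟨v, p, A, hp, hp1, hA, rfl⟩
  exact mem_Sep_of_fintype p A _ hp hp1 hA (isDensity_basis v)

theorem isDensity_sum {n : Type*} [Fintype n] [DecidableEq n] {p : ι → ℝ} (hp : ∀ k, 0 ≤ p k)
    (hp1 : ∑ k, p k = 1) {D : ι → Matrix n n ℂ} (hD : ∀ k, IsDensity (D k)) :
    IsDensity (∑ k, (p k : ℂ) • D k) := by
  refine ⟨posSemidef_sum _ fun k _ => (hD k).1.smul (Complex.zero_le_real.2 (hp k)), ?_⟩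
  simp only [trace_sum, trace_smul, (hD _).2, smul_eq_mul, mul_one]
  exact_mod_cast hp1

theorem exists_density_smul_eq_sum {n : Type*} [Fintype n] [DecidableEq n] [Nonempty ι]
    {p : ι → ℝ} (hp : ∀ k, 0 ≤ p k) {D : ι → Matrix n n ℂ} (hD : ∀ k, IsDensity (D k)) :
    ∃ B : Matrix n n ℂ, IsDensity B ∧ ((∑ k, p k : ℝ) : ℂ) • B = ∑ k, (p k : ℂ) • D k := by
  -- With zero total weight there is nothing to normalize, and any density operator serves.
  by_cases h : ∑ k, p k = 0
  · refine ⟨D (Classical.arbitrary ι), hD _, ?_⟩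
    have h0 := (Finset.sum_eq_zero_iff_of_nonneg fun k _ => hp k).1 h
    rw [h, Finset.sum_eq_zero fun k hk => by rw [h0 k hk]; simp]
    simp
  · refine ⟨∑ k, ((p k / ∑ k, p k : ℝ) : ℂ) • D k, isDensity_sum
      (fun k => div_nonneg (hp k) (Finset.sum_nonneg fun k _ => hp k)) ?_ hD, ?_⟩
    · rw [← Finset.sum_div, div_self h]
    · rw [Finset.smul_sum]
      refine Finset.sum_congr rfl fun k _ => ?_
      rw [smul_smul, ← Complex.ofReal_mul, mul_div_cancel₀ _ h]

theorem CC_subset_CQ : (CC : Set (Matrix (a × b) (a × b) ℂ)) ⊆ CQ := by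
  rintro _ ⟨u, v, p, hp, hp1, rfl⟩
  have hne : Nonempty b := by
    by_contra h
    rw [not_nonempty_iff] at h
    simp at hp1
  choose B hB hBe using fun j => exists_density_smul_eq_sum (hp j) (isDensity_basis v)
  refine ⟨u, fun j => ∑ k, p j k, B, fun j => Finset.sum_nonneg fun k _ => hp j k, hp1, hB, ?_⟩
  refine Finset.sum_congr rfl fun j _ => ?_
  rw [← kronecker_smul, hBe]
  ext x y
  simp only [Matrix.sum_apply, Matrix.smul_apply, kroneckerMap_apply, smul_eq_mul, Finset.mul_sum]
  exact Finset.sum_congr rfl fun k _ => by ring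

theorem CC_subset_QC : (CC : Set (Matrix (a × b) (a × b) ℂ)) ⊆ QC := by
  rintro _ ⟨u, v, p, hp, hp1, rfl⟩
  have hne : Nonempty a := by
    by_contra h
    rw [not_nonempty_iff] at h
    simp at hp1
  choose A hA hAe using fun k => exists_density_smul_eq_sum (p := fun j => p j k)
    (fun j => hp j k) (isDensity_basis u)
  refine ⟨v, fun k => ∑ j, p j k, A, fun k => Finset.sum_nonneg fun j _ => hp j k,
    by rw [Finset.sum_comm, hp1], hA, ?_⟩
  rw [Finset.sum_comm]
  refine Finset.sum_congr rfl fun k _ => ?_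
  rw [← smul_kronecker, hAe]
  ext x y
  simp only [Matrix.sum_apply, Matrix.smul_apply, kroneckerMap_apply, smul_eq_mul, Finset.sum_mul]
  exact Finset.sum_congr rfl fun k _ => by ring

/-- Each `A j ≤ 1`, so replacing it by `1` raises the sum to `1 ⊗ ∑ j, p j • B j`. Both relative
entropies decrease when the second argument grows. -/
theorem exists_oneTensor_ge_of_mem_Sep {σ : Matrix (a × b) (a × b) ℂ} (h : σ ∈ Sep) :
    σ.PosSemidef ∧ ∃ σ' ∈ oneTensor, σ ≤ σ' := by
  obtain ⟨N, p, A, B, hp, hp1, hA, hB, rfl⟩ := h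
  refine ⟨posSemidef_sum _ fun j _ =>
    ((hA j).1.kronecker (hB j).1).smul (Complex.zero_le_real.2 (hp j)),
    _, ⟨_, isDensity_sum hp hp1 hB, rfl⟩, ?_⟩
  have e : (1 : Matrix a a ℂ) ⊗ₖ (∑ k, (p k : ℂ) • B k)
      = ∑ k, (p k : ℂ) • ((1 : Matrix a a ℂ) ⊗ₖ B k) := by
    ext x y
    simp only [Matrix.sum_apply, Matrix.smul_apply, kroneckerMap_apply, smul_eq_mul, Finset.mul_sum]
    exact Finset.sum_congr rfl fun k _ => by ring
  rw [e]
  refine Finset.sum_le_sum fun k _ => ?_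
  rw [le_iff, ← smul_sub]
  refine PosSemidef.smul ?_ (Complex.zero_le_real.2 (hp k))
  have e2 : (1 : Matrix a a ℂ) ⊗ₖ B k - A k ⊗ₖ B k = (1 - A k) ⊗ₖ B k := by
    ext x y
    simp [sub_mul]
  rw [e2]
  exact (le_iff.1 (hA k).le_one).kronecker (hB k).1

/-- For a state supported on a subspace whose projection maps every `1 ⊗ τ` into `S`, the smoothed
distances to `S` and to the operators `1 ⊗ τ` agree. -/
theorem smoothInf_distTo_eq {S : Set (Matrix (a × b) (a × b) ℂ)} (hS : S ⊆ Sep)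
    {P : Matrix (a × b) (a × b) ℂ} (hP : P.IsHermitian) (hPP : P * P = P)
    (hPS : ∀ τ : Matrix b b ℂ, IsDensity τ → P * ((1 : Matrix a a ℂ) ⊗ₖ τ) * Pᴴ ∈ S)
    {ρ : Matrix (a × b) (a × b) ℂ} (hρ : IsDensity ρ) (hPρ : P * ρ * Pᴴ = ρ) (ε : ℝ) :
    smoothInf ε (distTo dMax S) ρ = smoothInf ε (distTo dMax oneTensor) ρ ∧
    smoothSup ε (distTo dFid S) ρ = smoothSup ε (distTo dFid oneTensor) ρ := by
  have hP1 : P ≤ 1 := by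
    have := posSemidef_conjTranspose_mul_self (1 - P)
    have e : (1 - P)ᴴ * (1 - P) = 1 - P := by
      rw [conjTranspose_sub, hP.eq, conjTranspose_one, Matrix.sub_mul, Matrix.mul_sub, Matrix.mul_sub,
        hPP]
      simp
    rwa [e, ← le_iff] at this
  -- `P` fixes `ρ` and moves across the fidelity: `F(ρ, σ) = F(PρP, σ) = F(ρ, PσP)`.
  have hball : ∀ σ ∈ epsBall ε ρ, P * σ * Pᴴ ∈ epsBall ε ρ := by
    intro σ hσ
    refine mem_epsBall_of_fid_le hρ.2 hρ.2 hσ ⟨hσ.1.1.mul_mul_conjTranspose_same P, ?_⟩ ?_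
    · refine le_trans ?_ hσ.1.2
      rw [Matrix.mul_assoc, Matrix.trace_mul_comm, Matrix.mul_assoc, hP.eq, hPP]
      simpa using trace_mul_re_mono hP1 hσ.1.1
    · conv_lhs => rw [← hPρ, fid_conj hρ.1 hσ.1.1]
      rw [hP.eq]
  have hle : ∀ D : Matrix (a × b) (a × b) ℂ → Matrix (a × b) (a × b) ℂ → EReal,
      (∀ σ P Q, P.PosSemidef → Q.PosSemidef → σ.PosSemidef → P ≤ Q → D σ Q ≤ D σ P) →
      ∀ σ : Matrix (a × b) (a × b) ℂ, σ.PosSemidef → distTo D oneTensor σ ≤ distTo D S σ := by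
    intro D hD σ hσ
    refine le_iInf₂ fun ω hω => ?_
    obtain ⟨hωp, ω', hω', h⟩ := exists_oneTensor_ge_of_mem_Sep (hS hω)
    exact (iInf₂_le ω' hω').trans
      (hD σ ω ω' hωp (posSemidef_of_mem_oneTensor hω') hσ h)
  constructor
  · refine le_antisymm (le_iInf₂ fun σ hσ => ?_) (iInf₂_mono fun σ hσ =>
      hle dMax (fun σ _ _ _ _ _ h => dMax_anti_right σ h) σ hσ.1.1)
    refine (iInf₂_le _ (hball σ hσ)).trans (le_iInf₂ ?_)
    rintro _ ⟨τ, hτ, rfl⟩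
    exact (iInf₂_le _ (hPS τ hτ)).trans (dMax_conj_le _ _ P)
  -- Here the projection moves from the second argument to the first: `D_fid(σ ‖ P(1 ⊗ τ)P) =
  -- D_fid(PσP ‖ 1 ⊗ τ)`.
  · refine le_antisymm (iSup₂_le fun σ hσ => ?_) (iSup₂_mono fun σ hσ =>
      hle dFid (fun σ _ _ hP hQ hσ h => dFid_le_of_fid_le (fid_mono_left h σ)) σ hσ.1.1)
    refine le_trans (le_iInf₂ ?_) (le_iSup₂ (f := fun σ (_ : σ ∈ epsBall ε _) =>
      distTo dFid oneTensor σ) _ (hball σ hσ))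
    rintro _ ⟨τ, hτ, rfl⟩
    refine (iInf₂_le _ (hPS τ hτ)).trans (dFid_le_of_fid_le ?_)
    rw [fid_conj hτ.one_kronecker_posSemidef hσ.1.1, hP.eq]

end Classes

/-! ### The premeasurement isometry, its range projection and the marginals. -/

section Premeasurement

variable {a c n J : Type*} [Fintype a] [DecidableEq a] [Fintype c] [DecidableEq c]
  [Fintype n] [DecidableEq n] [Fintype J]

theorem toEuclideanLin_ketbra (v x : EuclideanSpace ℂ n) :
    toEuclideanLin (ketbra v) x = inner ℂ v x • v := by
  ext i
  simp [ketbra, toLpLin_apply, vecMulVec_mulVec, EuclideanSpace.inner_eq_star_dotProduct,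
    dotProduct_comm]

/-- A commuting family of positive operators is jointly diagonalizable. -/
theorem exists_joint_eigenbasis {Y : J → Matrix n n ℂ} (hY : ∀ j, (Y j).PosSemidef)
    (hc : ∀ j k, j ≠ k → Commute (Y j) (Y k)) :
    ∃ (v : OrthonormalBasis n ℂ (EuclideanSpace ℂ n)) (μ : J → n → ℝ), (∀ j k, 0 ≤ μ j k) ∧
      ∀ j, Y j = ∑ k, (μ j k : ℂ) • ketbra (v k) := by
  classical
  set T : J → EuclideanSpace ℂ n →ₗ[ℂ] EuclideanSpace ℂ n := fun j => toEuclideanLin (Y j)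
  have hT : ∀ j, (T j).IsSymmetric := fun j =>
    isSymmetric_toEuclideanLin_iff.2 (hY j).isHermitian
  have hTc : Pairwise (Function.onFun Commute T) := by
    intro j k hjk
    ext x : 1
    have h := (hc j k hjk).eq
    simp only [T, Module.End.mul_apply, toLpLin_apply, mulVec_mulVec, h]
  have hint := LinearMap.IsSymmetric.directSum_isInternal_of_pairwise_commute hT hTc
  have hort := LinearMap.IsSymmetric.orthogonalFamily_iInf_eigenspaces hT
  set V : (J → ℂ) → Submodule ℂ (EuclideanSpace ℂ n) :=
    fun χ => ⨅ j, Module.End.eigenspace (T j) (χ j)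
  -- The joint eigenspaces are indexed by all families `χ : J → ℂ`; only finitely many are nonzero,
  -- and a subordinate orthonormal basis needs a finite index.
  have hfin : {χ | V χ ≠ ⊥}.Finite :=
    WellFoundedGT.finite_ne_bot_of_iSupIndep hint.submodule_iSupIndep
  have : Fintype {χ // V χ ≠ ⊥} := hfin.fintype
  have hint' := DirectSum.isInternal_ne_bot_iff.2 hint
  have hort' : OrthogonalFamily ℂ (fun χ : {χ // V χ ≠ ⊥} => V χ) fun χ => (V χ).subtypeₗᵢ :=
    hort.comp Subtype.val_injective
  have hn : Module.finrank ℂ (EuclideanSpace ℂ n) = Fintype.card n := finrank_euclideanSpace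
  set v := (hint'.subordinateOrthonormalBasis hn hort').reindex (Fintype.equivFin n).symm
  have hv : ∀ k, ∃ χ : J → ℂ, ∀ j, T j (v k) = χ j • v k := by
    intro k
    have h := hint'.subordinateOrthonormalBasis_subordinate hn (Fintype.equivFin n k) hort'
    set χ := hint'.subordinateOrthonormalBasisIndex hn (Fintype.equivFin n k) hort'
    have h' : v k ∈ V χ := by simpa [v] using h
    exact ⟨χ, fun j => Module.End.mem_eigenspace_iff.1 ((Submodule.mem_iInf _).1 h' j)⟩
  choose χ hχ using hv
  have hpos : ∀ j k, 0 ≤ χ k j := by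
    intro j k
    have h1 := (hY j).dotProduct_mulVec_nonneg (v k).ofLp
    have h2 : star (v k).ofLp ⬝ᵥ (Y j *ᵥ (v k).ofLp) = inner ℂ (v k) (T j (v k)) := by
      rw [EuclideanSpace.inner_eq_star_dotProduct, dotProduct_comm]
      simp [T, toLpLin_apply]
    rw [h2, hχ, inner_smul_right, inner_self_eq_norm_sq_to_K, v.orthonormal.1 k] at h1
    simpa using h1
  refine ⟨v, fun j k => (χ k j).re, fun j k => (Complex.le_def.1 (hpos j k)).1, fun j => ?_⟩
  apply toEuclideanLin.injective
  refine v.toBasis.ext fun k => ?_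
  have hre : (((χ k j).re : ℝ) : ℂ) = χ k j :=
    Complex.ext rfl (Complex.le_def.1 (hpos j k)).2
  rw [OrthonormalBasis.coe_toBasis, map_sum, LinearMap.sum_apply, Finset.sum_eq_single k]
  · rw [map_smul, LinearMap.smul_apply, toEuclideanLin_ketbra, inner_self_eq_norm_sq_to_K,
      v.orthonormal.1 k, hre]
    simpa using hχ k j
  · intro l _ hl
    rw [map_smul, LinearMap.smul_apply, toEuclideanLin_ketbra, v.orthonormal.2 hl]
    simp
  · simp

theorem exists_orthonormalBasis_extension {w : J → EuclideanSpace ℂ a} (hw : Orthonormal ℂ w) :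
    ∃ (f : J → a) (u : OrthonormalBasis a ℂ (EuclideanSpace ℂ a)),
      Function.Injective f ∧ ∀ j, u (f j) = w j := by
  classical
  have hcard : Fintype.card J ≤ Fintype.card a := by
    have := hw.linearIndependent.fintype_card_le_finrank
    rwa [finrank_euclideanSpace] at this
  obtain ⟨f⟩ := Function.Embedding.nonempty_of_card_le hcard
  set w' : a → EuclideanSpace ℂ a := Function.extend f w 0
  have hw' : ∀ j, w' (f j) = w j := fun j => f.injective.extend_apply w 0 j
  have hort : Orthonormal ℂ ((Set.range f).domRestrict w') := by
    have h := hw.comp (Equiv.ofInjective f f.injective).symm (Equiv.injective _)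
    convert h using 1
    ext1 x
    obtain ⟨j, rfl⟩ := (Equiv.ofInjective f f.injective).surjective x
    rw [Function.comp_apply, Equiv.symm_apply_apply]
    exact hw' j
  obtain ⟨u, hu⟩ := hort.exists_orthonormalBasis_extension_of_card_eq (by simp)
  exact ⟨f, u, f.injective, fun j => (hu _ ⟨j, rfl⟩).trans (hw' j)⟩

theorem sum_sum_sum_ite {M : Type*} [AddCommMonoid M] (f : J → a)
    (G : a → J → n → M) :
    ∑ i, ∑ k, ∑ j, (if f j = i then G i j k else 0) = ∑ j, ∑ k, G (f j) j k := by
  refine (Finset.sum_congr rfl fun i _ => Finset.sum_comm).trans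
    (Finset.sum_comm.trans (Finset.sum_congr rfl fun j _ => ?_))
  rw [Finset.sum_comm]
  simp

theorem sum_mem_CC {w : J → EuclideanSpace ℂ a} (hw : Orthonormal ℂ w) {Y : J → Matrix n n ℂ}
    (hY : ∀ j, (Y j).PosSemidef) (hc : ∀ j k, j ≠ k → Commute (Y j) (Y k))
    (htr : ∑ j, (Y j).trace = 1) : ∑ j, ketbra (w j) ⊗ₖ Y j ∈ CC := by
  classical
  obtain ⟨v, μ, hμ, hYμ⟩ := exists_joint_eigenbasis hY hc
  obtain ⟨f, u, hf, hu⟩ := exists_orthonormalBasis_extension hw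
  -- Basis vectors of the device outside the family `w` receive weight zero.
  refine ⟨u, v, fun i k => ∑ j, if f j = i then μ j k else 0, fun i k =>
    Finset.sum_nonneg fun j _ => by split_ifs <;> simp [hμ], ?_, ?_⟩
  · have h1 : ∀ j, (Y j).trace = ((∑ k, μ j k : ℝ) : ℂ) := by
      intro j
      rw [hYμ j, trace_sum]
      simp [(isDensity_basis v _).2]
    have h2 : ∑ j, ∑ k, μ j k = 1 := by
      simp only [h1] at htr
      exact_mod_cast htr
    rw [← h2]
    exact sum_sum_sum_ite f fun _ j k => μ j k
  · have h3 : ∀ i k, ((∑ j, if f j = i then μ j k else 0 : ℝ) : ℂ) • (ketbra (u i) ⊗ₖ ketbra (v k))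
        = ∑ j, if f j = i then (μ j k : ℂ) • (ketbra (u i) ⊗ₖ ketbra (v k)) else 0 := by
      intro i k
      rw [Complex.ofReal_sum, Finset.sum_smul]
      refine Finset.sum_congr rfl fun j _ => ?_
      split_ifs <;> simp
    simp_rw [h3]
    rw [sum_sum_sum_ite f fun i j k => (μ j k : ℂ) • (ketbra (u i) ⊗ₖ ketbra (v k))]
    simp_rw [hu]
    refine Finset.sum_congr rfl fun j _ => ?_
    conv_lhs => rw [hYμ j]
    ext x y
    simp only [Matrix.sum_apply, Matrix.smul_apply, kroneckerMap_apply, smul_eq_mul,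
      Finset.mul_sum]
    exact Finset.sum_congr rfl fun k _ => by ring

/-- The operator `|v⟩ ⊗ X`. -/
def embed (v : EuclideanSpace ℂ a) (X : Matrix n n ℂ) : Matrix (a × n) n ℂ :=
  Matrix.of fun p q => v p.1 * X p.2 q

theorem premeasIso_eq_sum (w : J → EuclideanSpace ℂ a) (X : J → Matrix n n ℂ) :
    premeasIso w X = ∑ j, embed (w j) (X j) := by
  ext p q
  simp [premeasIso, embed, Matrix.sum_apply]

theorem kronecker_mul_embed (A : Matrix a a ℂ) (B : Matrix n n ℂ) (v : EuclideanSpace ℂ a)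
    (X : Matrix n n ℂ) :
    (A ⊗ₖ B) * embed v X = embed (toEuclideanLin A v) (B * X) := by
  ext p q
  simp only [mul_apply, kroneckerMap_apply, embed, of_apply, Fintype.sum_prod_type,
    toLpLin_apply, mulVec, dotProduct]
  rw [Finset.sum_mul_sum]
  exact Finset.sum_congr rfl fun i _ => Finset.sum_congr rfl fun k _ => by ring

theorem embed_conjTranspose_mul_embed (u v : EuclideanSpace ℂ a) (X Y : Matrix n n ℂ) :
    (embed u X)ᴴ * embed v Y = inner ℂ u v • (Xᴴ * Y) := by
  ext p q
  simp only [mul_apply, conjTranspose_apply, embed, of_apply, Fintype.sum_prod_type,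
    Matrix.smul_apply, smul_eq_mul, PiLp.inner_apply, RCLike.inner_apply]
  rw [Finset.sum_mul_sum]
  refine Finset.sum_congr rfl fun i _ => Finset.sum_congr rfl fun k _ => ?_
  simp
  ring

theorem inner_orthonormal {w : J → EuclideanSpace ℂ a} (hw : Orthonormal ℂ w) (j : J) :
    inner ℂ (w j) (w j) = (1 : ℂ) := by
  rw [inner_self_eq_norm_sq_to_K, hw.1 j]; simp

theorem premeasIso_isometry {w : J → EuclideanSpace ℂ a} (hw : Orthonormal ℂ w)
    {X : J → Matrix n n ℂ} (hX : IsPVM X) : (premeasIso w X)ᴴ * premeasIso w X = 1 := by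
  rw [premeasIso_eq_sum, conjTranspose_sum, Matrix.sum_mul, ← hX.sum_eq_one]
  refine Finset.sum_congr rfl fun j _ => ?_
  rw [Matrix.mul_sum, Finset.sum_eq_single j]
  · rw [embed_conjTranspose_mul_embed, inner_orthonormal hw, one_smul, (hX.isHermitian j).eq,
      hX.idem]
  · intro k _ hk
    rw [embed_conjTranspose_mul_embed, hw.2 hk.symm, zero_smul]
  · simp

/-- The projection `∑ j, |w j⟩⟨w j| ⊗ X j` onto the range of the premeasurement isometry. -/
def premeasProj (w : J → EuclideanSpace ℂ a) (X : J → Matrix n n ℂ) :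
    Matrix (a × n) (a × n) ℂ :=
  ∑ j, ketbra (w j) ⊗ₖ X j

theorem premeasProj_isHermitian (w : J → EuclideanSpace ℂ a) {X : J → Matrix n n ℂ}
    (hX : IsPVM X) : (premeasProj w X).IsHermitian := by
  rw [IsHermitian, premeasProj, conjTranspose_sum]
  refine Finset.sum_congr rfl fun j _ => ?_
  rw [conjTranspose_kronecker, (hX.isHermitian j).eq,
    show (ketbra (w j))ᴴ = ketbra (w j) from
      (posSemidef_vecMulVec_self_star (w j).ofLp).isHermitian]

theorem ketbra_mul_ketbra (u v : EuclideanSpace ℂ a) :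
    ketbra u * ketbra v = inner ℂ u v • vecMulVec u.ofLp (star v.ofLp) := by
  rw [ketbra, ketbra, vecMulVec_mul_vecMulVec, EuclideanSpace.inner_eq_star_dotProduct,
    dotProduct_comm]
  ext i j
  simp [vecMulVec_apply]
  ring

/-- Orthonormality of `w` alone kills the cross terms. -/
theorem premeasProj_conj {w : J → EuclideanSpace ℂ a} (hw : Orthonormal ℂ w)
    (X : J → Matrix n n ℂ) (τ : Matrix n n ℂ) :
    premeasProj w X * ((1 : Matrix a a ℂ) ⊗ₖ τ) * premeasProj w X
      = ∑ j, ketbra (w j) ⊗ₖ (X j * τ * X j) := by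
  simp only [premeasProj, Finset.sum_mul]
  refine Finset.sum_congr rfl fun j _ => ?_
  rw [Finset.mul_sum, Finset.sum_eq_single j]
  · rw [← mul_kronecker_mul, ← mul_kronecker_mul, Matrix.mul_one, ketbra_mul_ketbra,
      inner_orthonormal hw, one_smul]
    rfl
  · intro k _ hk
    rw [← mul_kronecker_mul, ← mul_kronecker_mul, Matrix.mul_one, ketbra_mul_ketbra,
      hw.2 hk.symm, zero_smul, zero_kronecker]
  · simp

theorem premeasProj_idem {w : J → EuclideanSpace ℂ a} (hw : Orthonormal ℂ w)
    {X : J → Matrix n n ℂ} (hX : IsPVM X) :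
    premeasProj w X * premeasProj w X = premeasProj w X := by
  have h := premeasProj_conj hw X 1
  rw [one_kronecker_one, Matrix.mul_one] at h
  simp only [Matrix.mul_one, hX.idem] at h
  exact h

theorem premeasProj_mul_premeasIso {w : J → EuclideanSpace ℂ a} (hw : Orthonormal ℂ w)
    {X : J → Matrix n n ℂ} (hX : IsPVM X) :
    premeasProj w X * premeasIso w X = premeasIso w X := by
  rw [premeasIso_eq_sum, premeasProj, Matrix.sum_mul]
  refine Finset.sum_congr rfl fun j _ => ?_
  rw [Matrix.mul_sum, Finset.sum_eq_single j]
  · rw [kronecker_mul_embed, hX.idem, toEuclideanLin_ketbra, inner_orthonormal hw, one_smul]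
  · intro k _ hk
    rw [kronecker_mul_embed, hX.orth j k hk.symm]
    ext p q
    simp [embed]
  · simp

theorem premeasProj_conj_mem_CC {w : J → EuclideanSpace ℂ a} (hw : Orthonormal ℂ w)
    {X : J → Matrix n n ℂ} (hX : IsPVM X) {τ : Matrix n n ℂ} (hτ : IsDensity τ) :
    premeasProj w X * ((1 : Matrix a a ℂ) ⊗ₖ τ) * (premeasProj w X)ᴴ ∈ CC := by
  rw [(premeasProj_isHermitian w hX).eq, premeasProj_conj hw]
  refine sum_mem_CC hw (fun j => ?_) (fun j k hjk => ?_) ?_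
  · simpa [(hX.isHermitian j).eq] using hτ.1.mul_mul_conjTranspose_same (X j)
  -- Distinct blocks commute because their products vanish in both orders; this makes the system
  -- side classical too.
  · have h : ∀ j k, j ≠ k → X j * τ * X j * (X k * τ * X k) = 0 := by
      intro j k hjk
      have : X j * τ * X j * (X k * τ * X k) = X j * τ * (X j * X k) * τ * X k := by
        simp only [Matrix.mul_assoc]
      rw [this, hX.orth j k hjk]
      simp
    exact (h j k hjk).trans (h k j hjk.symm).symm
  · have h : ∀ j, (X j * τ * X j).trace = (X j * τ).trace := by
      intro j
      rw [Matrix.trace_mul_comm, ← Matrix.mul_assoc, hX.idem]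
    simp_rw [h]
    rw [← trace_sum, ← Finset.sum_mul, hX.sum_eq_one, Matrix.one_mul, hτ.2]

theorem premeasState_isDensity {w : J → EuclideanSpace ℂ a} (hw : Orthonormal ℂ w)
    {X : J → Matrix n n ℂ} (hX : IsPVM X) {ρ : Matrix n n ℂ} (hρ : IsDensity ρ) :
    IsDensity (premeasState w X ρ) := by
  refine ⟨hρ.1.mul_mul_conjTranspose_same _, ?_⟩
  rw [premeasState, Matrix.trace_mul_comm, ← Matrix.mul_assoc, premeasIso_isometry hw hX,
    Matrix.one_mul, hρ.2]

theorem premeasProj_conj_premeasState {w : J → EuclideanSpace ℂ a} (hw : Orthonormal ℂ w)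
    {X : J → Matrix n n ℂ} (hX : IsPVM X) (ρ : Matrix n n ℂ) :
    premeasProj w X * premeasState w X ρ * (premeasProj w X)ᴴ = premeasState w X ρ := by
  have h := premeasProj_mul_premeasIso hw hX
  have h' := congrArg conjTranspose h
  rw [conjTranspose_mul] at h'
  rw [premeasState, ← Matrix.mul_assoc, ← Matrix.mul_assoc, h, Matrix.mul_assoc, h']

/-- A bipartite vector read as a matrix. -/
def vecToMatrix (ψ : EuclideanSpace ℂ (n × c)) : Matrix n c ℂ :=
  Matrix.of fun x k => ψ (x, k)

theorem traceRight_ketbra (ψ : EuclideanSpace ℂ (n × c)) :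
    traceRight (ketbra ψ) = vecToMatrix ψ * (vecToMatrix ψ)ᴴ := by
  ext i j
  simp [traceRight, ketbra, vecMulVec_apply, vecToMatrix, mul_apply]

/-- The global vector is the matrix `V_X Ψ`; tracing out the system instead of the environment
amounts to regrouping it. -/
theorem traceMid_premeasGlobal (w : J → EuclideanSpace ℂ a) (X : J → Matrix n n ℂ)
    (ψ : EuclideanSpace ℂ (n × c)) :
    traceMid (premeasGlobal w X ψ) = regroup (premeasIso w X * vecToMatrix ψ)
      * (regroup (premeasIso w X * vecToMatrix ψ))ᴴ := by
  have h : (premeasIso w X ⊗ₖ (1 : Matrix c c ℂ)) *ᵥ ψ.ofLp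
      = fun p => (premeasIso w X * vecToMatrix ψ) p.1 p.2 := by
    ext p
    simp [mulVec, dotProduct, Fintype.sum_prod_type, one_apply, mul_apply, vecToMatrix]
  have hG : premeasGlobal w X ψ
      = vecMulVec (fun p => (premeasIso w X * vecToMatrix ψ) p.1 p.2)
        (star fun p => (premeasIso w X * vecToMatrix ψ) p.1 p.2) := by
    rw [premeasGlobal, ketbra, mul_vecMulVec, vecMulVec_mul, h, ← star_mulVec, h]
  rw [hG]
  ext p q
  simp [traceMid, vecMulVec_apply, regroup, mul_apply]

end Premeasurement

end QCorr

end

theorem mainTheorem7 {m s e J : Type*} [Fintype m] [DecidableEq m] [Fintype s] [DecidableEq s]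
    [Fintype e] [DecidableEq e] [Fintype J]
    (w : J → EuclideanSpace ℂ m) (hw : Orthonormal ℂ w)
    (X : J → Matrix s s ℂ) (hX : QCorr.IsPVM X)
    (ρS : Matrix s s ℂ) (hρS : QCorr.IsDensity ρS)
    (ψ : EuclideanSpace ℂ (s × e)) (hψ : QCorr.traceRight (QCorr.ketbra ψ) = ρS)
    (ε : ℝ) (hε : 0 ≤ ε) :
    (QCorr.smoothHMinObs ε w X ψ = QCorr.smoothEntFid ε (QCorr.premeasState w X ρS) ∧
      QCorr.smoothEntFid ε (QCorr.premeasState w X ρS)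
        = QCorr.smoothDiscordFstFid ε (QCorr.premeasState w X ρS) ∧
      QCorr.smoothDiscordFstFid ε (QCorr.premeasState w X ρS)
        = QCorr.smoothDiscordSndFid ε (QCorr.premeasState w X ρS) ∧
      QCorr.smoothDiscordSndFid ε (QCorr.premeasState w X ρS)
        = QCorr.smoothDiscordTwoFid ε (QCorr.premeasState w X ρS)) ∧
    (QCorr.smoothHMaxObs ε w X ψ = QCorr.smoothEntMax ε (QCorr.premeasState w X ρS) ∧
      QCorr.smoothEntMax ε (QCorr.premeasState w X ρS)
        = QCorr.smoothDiscordFstMax ε (QCorr.premeasState w X ρS) ∧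
      QCorr.smoothDiscordFstMax ε (QCorr.premeasState w X ρS)
        = QCorr.smoothDiscordSndMax ε (QCorr.premeasState w X ρS) ∧
      QCorr.smoothDiscordSndMax ε (QCorr.premeasState w X ρS)
        = QCorr.smoothDiscordTwoMax ε (QCorr.premeasState w X ρS)) := by
  open QCorr in
  have hρ := premeasState_isDensity hw hX hρS
  have key := fun (S : Set (Matrix (m × s) (m × s) ℂ)) (hS : S ⊆ Sep) (hCS : CC ⊆ S) =>
    smoothInf_distTo_eq hS (premeasProj_isHermitian w hX) (premeasProj_idem hw hX)
      (fun τ hτ => hCS (premeasProj_conj_mem_CC hw hX hτ)) hρ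
      (premeasProj_conj_premeasState hw hX ρS) ε
  have hSep := key Sep subset_rfl (CC_subset_CQ.trans CQ_subset_Sep)
  have hCQ := key CQ CQ_subset_Sep CC_subset_CQ
  have hQC := key QC QC_subset_Sep CC_subset_QC
  have hCC := key CC (CC_subset_CQ.trans CQ_subset_Sep) subset_rfl
  have hK : premeasState w X ρS = (premeasIso w X * vecToMatrix ψ)
      * (premeasIso w X * vecToMatrix ψ).conjTranspose := by
    rw [premeasState, ← hψ, traceRight_ketbra, Matrix.conjTranspose_mul]
    simp only [Matrix.mul_assoc]
  have hs : Nonempty s := by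
    by_contra h
    rw [not_nonempty_iff] at h
    simpa [Matrix.trace] using hρS.2
  have he : Nonempty e := by
    by_contra h
    rw [not_nonempty_iff] at h
    have := hρS.2
    rw [← hψ] at this
    simp [Matrix.trace, traceRight] at this
  have htr := hρ.2
  rw [hK, ← trace_regroup_self] at htr
  -- Duality is applied to the regrouped matrix, whose own marginal is that of device and
  -- environment; regrouping again returns the premeasurement state.
  have hmin := smoothHMin_eq htr ε
  have hmax := smoothHMax_eq htr ε
  rw [regroup_regroup, ← hK, ← traceMid_premeasGlobal] at hmin hmax
  exact ⟨⟨hmin.trans hSep.2.symm, hSep.2.trans hCQ.2.symm, hCQ.2.trans hQC.2.symm,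
    hQC.2.trans hCC.2.symm⟩, hmax.trans hSep.1.symm, hSep.1.trans hCQ.1.symm,
    hCQ.1.trans hQC.1.symm, hQC.1.trans hCC.1.symm⟩
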